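/- **Definitions.** A ranked alphabet is a finite set $\Sigma$ with a rank function $\Sigma\to\mathbb N$; $\Sigma^{(n)}$ is the set of its symbols of rank $n$, and $\sigma^{(n)}$ indicates that $\sigma$ has rank $n$. For a set $H$, $T_\Sigma(H)$ is the set of finite ordered trees over $\Sigma$ in which, additionally, elements of $H$ may label leaves; $T_\Sigma=T_\Sigma(\emptyset)$. A tree language is a ranked alphabet $\Sigma$ together with a set $L\subseteq T_\Sigma$. A counter tree automaton over $\Sigma$ is a tuple $\mathcal A=(Q,\Sigma,q_0,\Delta)$ with $Q$ a finite set of states, $q_0\in Q$, and $\Delta$ a finite set of transitions of the forms $q\xrightarrow{p/z}q'$ and $q\xrightarrow{p/z}\sigma(q_1,\dots,q_n)$, where $n\in\mathbb N$, $\sigma\in\Sigma^{(n)}$, $q,q',q_1,\dots,q_n\in Q$, $z\in\mathbb Z$, and $p\in\{0,{>}0,\top\}$ is a test on the counter value ($=0$, $\ge 1$, always true). It has two semantics. * *Global (GOCTA).* Configurations are pairs $(\zeta,m)\in T_\Sigma(Q)\times\mathbb N$. In one step, a transition with left-hand side $q$, test $p$ and instruction $z$ is applied at the lexicographically first position of $\zeta$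 that carries a state, provided this state is $q$, $p(m)$ holds and $m+z\ge 0$; the state is replaced by the right-hand side of the transition, and $m$ by $m+z$. The recognized language consists of all $\xi\in T_\Sigma$ such that $(\xi,m)$ is reachable from $(q_0,0)$ for some $m\in\mathbb N$. * *Copying (OCTA).* Configurations are trees $\zeta\in T_\Sigma(Q\times\mathbb N)$. In one step, at an arbitrary position of $\zeta$ labelled $(q,m)$, a transition with left-hand side $q$, test $p$ and instruction $z$ is applied, provided $p(m)$ holds and $m+z\ge 0$; the label is replaced by $(q',m+z)$, respectively by $\sigma((q_1,m+z),\dots,(q_n,m+z))$. The recognized language consists of all $\xi\in T_\Sigma$ reachable from the tree $(q_0,0)$. A tree language $L\subseteq T_\Sigma$ is GOCTA-recognizable (OCTA-recognizable) if it is the language recognized by some counter tree automaton over $\Sigma$ under the global (copying) semantics. **Corollary.** The class of OCTA-recognizable tree languages and the class of GOCTA-recognizable tree languages are incomparable: neither is contained in the other. More precisely: 1. over $\{\sigma^{(2)},a^{(1)},b^{(1)},c^{(1)},\#^{(0)}\}$, the tree language $L_{a\sigma bc}=\{a^n(\sigma(b^n\#,c^n\#))\mid n\in\mathbb N\}$ is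 OCTA-recognizable but not GOCTA-recognizable; 2. over $\{\sigma^{(3)},a^{(1)},b^{(1)},\#^{(0)}\}$, the tree language $L_{a=b}$ of all $\xi=\sigma(\xi_1,\xi_2,\xi_3)$ such that $\xi_1,\xi_2,\xi_3$ contain only the symbols $a,b,\#$ and $\xi$ contains as many occurrences of $a$ as of $b$ is GOCTA-recognizable but not OCTA-recognizable. -/

import Mathlib

namespace TreeCounter

/-- A ranked alphabet: a finite set of symbols together with a rank function. -/
structure RankedAlphabet where
  Symb : Type
  finite_symb : Finite Symb
  rank : Symb → ℕ

/-- The set `T_Σ(H)` of trees over the ranked alphabet `S` and indexed by `H`. -/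
inductive RTree (S : RankedAlphabet) (H : Type) : Type
  | leaf (h : H) : RTree S H
  | node (s : S.Symb) (ts : Fin (S.rank s) → RTree S H) : RTree S H

/-- The set `T_Σ = T_Σ(∅)`. -/
abbrev GroundTree (S : RankedAlphabet) : Type := RTree S Empty

namespace RTree

variable {S : RankedAlphabet} {H H' : Type}

/-- Simultaneous replacement of every leaf `h ∈ H` by the tree `f h`. -/
def subst (f : H → RTree S H') : RTree S H → RTree S H'
  | leaf h => f h
  | node s ts => node s (fun i => subst f (ts i))

/-- The inclusion `T_Σ ⊆ T_Σ(H)`. -/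
def incl (ξ : GroundTree S) : RTree S H := ξ.subst Empty.elim

/-- The leaves labelled by elements of `H`, listed in lexicographic order of their positions. -/
def frontier : RTree S H → List H
  | leaf h => [h]
  | node _ ts => (List.ofFn (fun i => frontier (ts i))).flatten

/-- `C` belongs to `C_Σ(H, X_k)`: each variable `x_1, …, x_k` (here: the elements of `Fin k`)
occurs exactly once, and they occur in lexicographic order of their positions. -/
def IsContext {k : ℕ} (C : RTree S (H ⊕ Fin k)) : Prop :=
  C.frontier.filterMap Sum.getRight? = List.finRange k

/-- The number `|ξ|_s` of positions of a tree that are labelled by the symbol `s`. -/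
def count [DecidableEq S.Symb] (s : S.Symb) : RTree S H → ℕ
  | leaf _ => 0
  | node s' ts => (if s' = s then 1 else 0) + ∑ i, count s (ts i)

/-- All symbols of the tree belong to `A`, that is, it is a tree over the sub-alphabet `A`. -/
def IsOver (A : Set S.Symb) : RTree S H → Prop
  | leaf _ => True
  | node s ts => s ∈ A ∧ ∀ i, IsOver A (ts i)

end RTree

/-- The counter tests `0`, `>0` and `⊤`. -/
inductive CounterTest : Type
  | zero
  | pos
  | top

/-- The test holds for the counter value `m`. -/
def CounterTest.Holds : CounterTest → ℕ → Prop
  | zero, m => m = 0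
  | pos, m => 1 ≤ m
  | top, _ => True

/-- The right-hand side of a transition: a state `q'` (for an `ε`-transition), or
`s(q_1, …, q_n)` with `n` the rank of `s` (for a read-transition). -/
inductive Target (S : RankedAlphabet) (Q : Type) : Type
  | eps (q' : Q) : Target S Q
  | read (s : S.Symb) (qs : Fin (S.rank s) → Q) : Target S Q

/-- The right-hand side of a transition as a tree in `T_Σ(H)`, where each state `q` is
written as `g q ∈ H`. -/
def Target.toTree {S : RankedAlphabet} {Q H : Type} (g : Q → H) : Target S Q → RTree S H
  | eps q' => .leaf (g q')
  | read s qs => .node s (fun i => .leaf (g (qs i)))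

/-- A transition `src --test/instr--> target`. -/
structure Transition (S : RankedAlphabet) (Q : Type) where
  src : Q
  test : CounterTest
  instr : ℤ
  target : Target S Q

/-- A global one-counter tree automaton over the ranked alphabet `S`. -/
structure GOCTA (S : RankedAlphabet) where
  Q : Type
  finite_states : Finite Q
  init : Q
  trans : Set (Transition S Q)
  finite_trans : trans.Finite

/-- One step by the transition `τ` on configurations in `T_Σ(Q) × ℕ`: it is applied at the
lexicographically first position carrying a state, and there is a single counter.
The tree is `C[q, q_1, …, q_k]` for a context `C ∈ C_Σ(X_{k+1})`. -/
def Transition.GlobalStep {S : RankedAlphabet} {Q : Type} (τ : Transition S Q)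
    (c c' : RTree S Q × ℕ) : Prop :=
  ∃ (k : ℕ) (C : RTree S (Empty ⊕ Fin (k + 1))) (qs : Fin k → Q),
    C.IsContext ∧
    c.1 = C.subst (Sum.elim Empty.elim (Fin.cons (.leaf τ.src) (fun i => .leaf (qs i)))) ∧
    τ.test.Holds c.2 ∧
    c'.1 = C.subst (Sum.elim Empty.elim (Fin.cons (τ.target.toTree id) (fun i => .leaf (qs i)))) ∧
    (c'.2 : ℤ) = (c.2 : ℤ) + τ.instr

/-- One step by the transition `τ` on `T_Σ(Q × ℕ)`: it is applied at an arbitrary position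
carrying a state with its own counter, and the new counter value is copied to all successors. -/
def Transition.CopyStep {S : RankedAlphabet} {Q : Type} (τ : Transition S Q)
    (ζ ζ' : RTree S (Q × ℕ)) : Prop :=
  ∃ (C : RTree S ((Q × ℕ) ⊕ Fin 1)) (m m' : ℕ),
    C.IsContext ∧
    ζ = C.subst (Sum.elim .leaf (fun _ => .leaf (τ.src, m))) ∧
    τ.test.Holds m ∧
    (m' : ℤ) = (m : ℤ) + τ.instr ∧
    ζ' = C.subst (Sum.elim .leaf (fun _ => τ.target.toTree (fun q => (q, m'))))

namespace GOCTA

variable {S : RankedAlphabet}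

/-- The computation relation of the automaton with a global counter. -/
def GlobalStep (A : GOCTA S) (c c' : RTree S A.Q × ℕ) : Prop :=
  ∃ τ ∈ A.trans, τ.GlobalStep c c'

/-- The computation relation of the automaton with copying of the counter. -/
def CopyStep (A : GOCTA S) (ζ ζ' : RTree S (A.Q × ℕ)) : Prop :=
  ∃ τ ∈ A.trans, τ.CopyStep ζ ζ'

/-- The language recognized by the automaton with a global counter. -/
def language (A : GOCTA S) : Set (GroundTree S) :=
  {ξ | ∃ m : ℕ, Relation.ReflTransGen A.GlobalStep (.leaf A.init, 0) (ξ.incl, m)}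

/-- The language recognized by the automaton with copying of the counter. -/
def copyLanguage (A : GOCTA S) : Set (GroundTree S) :=
  {ξ | Relation.ReflTransGen A.CopyStep (.leaf (A.init, 0)) ξ.incl}

end GOCTA

/-- `L` is recognizable by a GOCTA. -/
def GOCTARecognizable {S : RankedAlphabet} (L : Set (GroundTree S)) : Prop :=
  ∃ A : GOCTA S, A.language = L

/-- `L` is recognizable by an OCTA. -/
def OCTARecognizable {S : RankedAlphabet} (L : Set (GroundTree S)) : Prop :=
  ∃ A : GOCTA S, A.copyLanguage = L

/-- A tree language: a ranked alphabet `S` together with a set of trees over `S`. -/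
abbrev TreeLanguage : Type 1 := Σ S : RankedAlphabet, Set (GroundTree S)

/-- The class of tree languages recognizable by GOCTA. -/
def classGOCTA : Set TreeLanguage := {L | GOCTARecognizable L.2}

/-- The class of tree languages recognizable by OCTA. -/
def classOCTA : Set TreeLanguage := {L | OCTARecognizable L.2}

/-- The symbols `σ, a, b, c, #`. -/
inductive Symb₁ : Type
  | sigma
  | a
  | b
  | c
  | hash

/-- The ranked alphabet with `σ` of rank `2`, with `a`, `b`, `c` of rank `1`,
and with `#` of rank `0`. -/
def alphabet₁ : RankedAlphabet where
  Symb := Symb₁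
  finite_symb := Finite.of_surjective
    (fun i : Fin 5 => ![Symb₁.sigma, Symb₁.a, Symb₁.b, Symb₁.c, Symb₁.hash] i)
    (fun s => by
      cases s
      exacts [⟨0, rfl⟩, ⟨1, rfl⟩, ⟨2, rfl⟩, ⟨3, rfl⟩, ⟨4, rfl⟩])
  rank
    | .sigma => 2
    | .a => 1
    | .b => 1
    | .c => 1
    | .hash => 0

namespace Trees₁

def sigma (t₁ t₂ : GroundTree alphabet₁) : GroundTree alphabet₁ :=
  RTree.node (S := alphabet₁) Symb₁.sigma ![t₁, t₂]

def a (t : GroundTree alphabet₁) : GroundTree alphabet₁ :=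
  RTree.node (S := alphabet₁) Symb₁.a (fun _ => t)

def b (t : GroundTree alphabet₁) : GroundTree alphabet₁ :=
  RTree.node (S := alphabet₁) Symb₁.b (fun _ => t)

def c (t : GroundTree alphabet₁) : GroundTree alphabet₁ :=
  RTree.node (S := alphabet₁) Symb₁.c (fun _ => t)

def hash : GroundTree alphabet₁ :=
  RTree.node (S := alphabet₁) Symb₁.hash Fin.elim0

end Trees₁

/-- The tree language `{aⁿ(σ(bⁿ#, cⁿ#)) | n ∈ ℕ}`. -/
def langASigmaBC : Set (GroundTree alphabet₁) :=
  {ξ | ∃ n : ℕ, ξ =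
    Trees₁.a^[n] (Trees₁.sigma (Trees₁.b^[n] Trees₁.hash) (Trees₁.c^[n] Trees₁.hash))}

/-- The symbols `σ, a, b, #`. -/
inductive Symb₂ : Type
  | sigma
  | a
  | b
  | hash
  deriving DecidableEq

/-- The ranked alphabet with `σ` of rank `3`, with `a`, `b` of rank `1`,
and with `#` of rank `0`. -/
def alphabet₂ : RankedAlphabet where
  Symb := Symb₂
  finite_symb := Finite.of_surjective
    (fun i : Fin 4 => ![Symb₂.sigma, Symb₂.a, Symb₂.b, Symb₂.hash] i)
    (fun s => by
      cases s
      exacts [⟨0, rfl⟩, ⟨1, rfl⟩, ⟨2, rfl⟩, ⟨3, rfl⟩])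
  rank
    | .sigma => 3
    | .a => 1
    | .b => 1
    | .hash => 0

instance : DecidableEq alphabet₂.Symb := inferInstanceAs (DecidableEq Symb₂)

/-- The tree language of all `ξ = σ(ξ₁, ξ₂, ξ₃)` with `ξ₁, ξ₂, ξ₃ ∈ T_{a,b,#}` and
`|ξ|_a = |ξ|_b`. -/
def langAEqB : Set (GroundTree alphabet₂) :=
  {ξ | (∃ ξ₁ ξ₂ ξ₃ : GroundTree alphabet₂,
      ξ = RTree.node (S := alphabet₂) Symb₂.sigma ![ξ₁, ξ₂, ξ₃] ∧
      ξ₁.IsOver ({Symb₂.a, Symb₂.b, Symb₂.hash} : Set Symb₂) ∧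
      ξ₂.IsOver ({Symb₂.a, Symb₂.b, Symb₂.hash} : Set Symb₂) ∧
      ξ₃.IsOver ({Symb₂.a, Symb₂.b, Symb₂.hash} : Set Symb₂)) ∧
    ξ.count (Symb₂.a : alphabet₂.Symb) = ξ.count (Symb₂.b : alphabet₂.Symb)}

end TreeCounter

/-! Both negative results rest on one pumping fact for one-counter systems
(`CounterRun.exists_pump`). Let the instructions be bounded by `Z` and let a run start at a counter
value of at least `|P|(Z+1)`. Either the counter is positive before every step, and the whole run
can be raised by any amount, or the run descends to zero and on the way revisits a state at a value
lower by some `g ≤ (|P|+1)(Z+1)`. A positive counter stays positive when raised, so all tests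
survive. Raising the start by `k * g` is therefore absorbed by `k` extra copies of the loop, and the
label of the run grows by `k • δ`.

The automata enter through cutting below `σ`: acceptance depends only on the states and the counter
handed to the subtrees, so subtrees accepted from equal data may be exchanged. Exchange makes these
data injective in a parameter. Hence some tuple of states and some residue of the counter modulo
`B!` recur with arbitrarily large counters, where `B = (|P|+1)(Z+1)`. Since `g ∣ B!`, the gap
between two such counters is a multiple of `g` and is bridged by pumping.

Global counter, `aⁿ(σ(bⁿ#, cⁿ#))`: processing `bⁿ#` and then `cⁿ#` is one run. Its loop lies on one
side only and cannot change both exponents, whereas passing from `n` to a different `n'` must.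

Copied counter, `|ξ|_a = |ξ|_b`: the branches of `σ(ξ₁, ξ₂, ξ₃)` run independently. The state and
counter of the first branch must determine its difference `K`, while varying the second branch makes
the counter unbounded for each `K`. Pumping between two counters for the same `K` forces `δ = 0`,
and pumping towards another `K'` with the same states and residue then gives `K = K'`.

The positive results are explicit automata. A copied counter compares `n` with both branches. A
global counter holds the absolute value of the running difference, with its sign in the state and
the sign at each subtree boundary guessed at `σ`. -/

namespace TreeCounter

/-! ### Leaf replacement in trees and its description by contexts -/

namespace RTree

variable {S : RankedAlphabet} {H H' K : Type}

theorem subst_congr {f f' : H → RTree S H'} :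
    ∀ C : RTree S H, (∀ h ∈ C.frontier, f h = f' h) → C.subst f = C.subst f'
  | leaf h, hf => hf h (by simp [frontier])
  | node s ts, hf => by
    simp only [subst]
    congr 1
    funext i
    refine subst_congr (ts i) fun h hh => hf h ?_
    simp only [frontier, List.mem_flatten, List.mem_ofFn]
    exact ⟨_, ⟨i, rfl⟩, hh⟩

theorem mem_frontier_subst {f : H → RTree S H'} {x : H'} :
    ∀ {C : RTree S H}, x ∈ (C.subst f).frontier → ∃ h ∈ C.frontier, x ∈ (f h).frontier
  | leaf h, hx => ⟨h, by simp [frontier], hx⟩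
  | node s ts, hx => by
    simp only [subst, frontier, List.mem_flatten, List.mem_ofFn] at hx
    obtain ⟨_, ⟨i, rfl⟩, hx⟩ := hx
    obtain ⟨h, hh, hx⟩ := mem_frontier_subst hx
    refine ⟨h, ?_, hx⟩
    simp only [frontier, List.mem_flatten, List.mem_ofFn]
    exact ⟨_, ⟨i, rfl⟩, hh⟩

theorem frontier_incl (ξ : GroundTree S) : (ξ.incl : RTree S H).frontier = [] := by
  refine List.eq_nil_iff_forall_not_mem.2 fun x hx => ?_
  obtain ⟨h, _⟩ := mem_frontier_subst hx
  exact h.elim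

theorem incl_node (s : S.Symb) (ts : Fin (S.rank s) → GroundTree S) :
    (incl (node s ts) : RTree S H) = node s fun i => (ts i).incl := rfl

/-- `Repl l h t ζ ζ'`: the tree `ζ'` arises from `ζ` by replacing one leaf labelled `h` by `t`;
if `l` holds, then no leaf to the left of it carries a label. -/
inductive Repl (l : Prop) (h : H) (t : RTree S H) : RTree S H → RTree S H → Prop
  | leaf : Repl l h t (leaf h) t
  | node (s : S.Symb) (ts : Fin (S.rank s) → RTree S H) (i : Fin (S.rank s)) (t' : RTree S H) :
      (l → ∀ j < i, (ts j).frontier = []) → Repl l h t (ts i) t' →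
      Repl l h t (node s ts) (node s (Function.update ts i t'))

theorem Repl.mem_frontier {l : Prop} {h : H} {t ζ ζ' : RTree S H} (r : Repl l h t ζ ζ') :
    h ∈ ζ.frontier := by
  induction r with
  | leaf => simp [frontier]
  | node s ts i t' _ _ ih =>
    simp only [frontier, List.mem_flatten, List.mem_ofFn]
    exact ⟨_, ⟨i, rfl⟩, ih⟩

theorem Repl.unique {h : H} {t ζ ζ₁ ζ₂ : RTree S H} (r : Repl True h t ζ ζ₁)
    (r' : Repl True h t ζ ζ₂) : ζ₁ = ζ₂ := by
  induction r generalizing ζ₂ with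
  | leaf => cases r'; rfl
  | node s ts i t' hi r ih =>
    cases r' with
    | node _ _ i' t'' hi' r'' =>
    rcases lt_trichotomy i i' with hlt | rfl | hlt
    · simpa [hi' trivial i hlt] using r.mem_frontier
    · rw [ih r'']
    · simpa [hi trivial i' hlt] using r''.mem_frontier

/-- Locates the child that contains the leftmost entry of a frontier, with empty blocks before it.
-/
theorem flatten_ofFn_eq_cons {α : Type} {x : α} {rest : List α} :
    ∀ {n : ℕ} {L : Fin n → List α}, (List.ofFn L).flatten = x :: rest →
      ∃ i r, (∀ j < i, L j = []) ∧ L i = x :: r ∧ (∀ y ∈ r, y ∈ rest) ∧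
        ∀ j > i, ∀ y ∈ L j, y ∈ rest
  | 0, L, h => by simp at h
  | n + 1, L, h => by
    rw [List.ofFn_succ, List.flatten_cons] at h
    rcases hL : L 0 with _ | ⟨x', r⟩
    · rw [hL, List.nil_append] at h
      obtain ⟨i, r, h₁, h₂, h₃, h₄⟩ := flatten_ofFn_eq_cons h
      refine ⟨i.succ, r, ?_, h₂, h₃, ?_⟩
      · intro j hj
        cases j using Fin.cases with
        | zero => exact hL
        | succ j => exact h₁ j (Fin.succ_lt_succ_iff.1 hj)
      · intro j hj
        cases j using Fin.cases with
        | zero => exact absurd hj (Fin.not_lt_zero _)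
        | succ j => exact h₄ j (Fin.succ_lt_succ_iff.1 hj)
    · rw [hL, List.cons_append, List.cons.injEq] at h
      obtain ⟨rfl, rfl⟩ := h
      refine ⟨0, r, fun j hj => absurd hj (Fin.not_lt_zero _), hL,
        fun y hy => List.mem_append_left _ hy, ?_⟩
      intro j hj y hy
      cases j using Fin.cases with
      | zero => exact absurd hj (lt_irrefl _)
      | succ j =>
        refine List.mem_append_right _ ?_
        simp only [List.mem_flatten, List.mem_ofFn]
        exact ⟨_, ⟨j, rfl⟩, hy⟩

/-- Serves both semantics: the global step has `K = Empty` and `l = True`, the copying step has `l =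
False` and a single variable. The condition `x ∉ rest` says that `x` occurs once, so only one child
changes at each node on the way down. -/
theorem repl_of_frontier {n : ℕ} {l : Prop} {g : K → RTree S H}
    (hg : l → ∀ z, (g z).frontier = []) {f f' : Fin n → RTree S H} {x : Fin n} {h : H}
    (hx : f x = leaf h) (hf : ∀ y, y ≠ x → f y = f' y) :
    ∀ (C : RTree S (K ⊕ Fin n)) (rest : List (Fin n)),
      C.frontier.filterMap Sum.getRight? = x :: rest → x ∉ rest →
      Repl l h (f' x) (C.subst (Sum.elim g f)) (C.subst (Sum.elim g f'))
  | leaf (.inl k), rest, hC, _ => by cases hC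
  | leaf (.inr y), rest, hC, _ => by
    simp only [frontier, List.filterMap_cons, Sum.getRight?_inr, List.filterMap_nil,
      List.cons.injEq] at hC
    obtain ⟨rfl, -⟩ := hC
    simp only [subst, Sum.elim_inr, hx]
    exact .leaf
  | node s ts, rest, hC, hr => by
    rw [frontier, List.filterMap_flatten, List.map_ofFn] at hC
    obtain ⟨i, r, h₁, h₂, h₃, h₄⟩ := flatten_ofFn_eq_cons hC
    have key : ∀ j, x ∉ (ts j).frontier.filterMap Sum.getRight? →
        (ts j).subst (Sum.elim g f) = (ts j).subst (Sum.elim g f') := by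
      intro j hj
      refine subst_congr _ ?_
      rintro (z | y) hy
      · rfl
      · refine hf y ?_
        rintro rfl
        exact hj (List.mem_filterMap.2 ⟨_, hy, rfl⟩)
    have e : (node s ts).subst (Sum.elim g f') = node s (Function.update
        (fun j => (ts j).subst (Sum.elim g f)) i ((ts i).subst (Sum.elim g f'))) := by
      simp only [subst]
      congr 1
      funext j
      rcases lt_trichotomy j i with hj | rfl | hj
      · rw [Function.update_of_ne hj.ne, key]
        have := h₁ j hj
        simp only [Function.comp_apply] at this
        simp [this]
      · simp
      · rw [Function.update_of_ne hj.ne', key]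
        exact fun hx => hr (h₄ j hj x hx)
    rw [e, subst]
    refine .node s _ i _ ?_ (repl_of_frontier hg hx hf (ts i) r h₂ fun hx => hr (h₃ x hx))
    intro hl j hj
    refine List.eq_nil_iff_forall_not_mem.2 fun w hw => ?_
    obtain ⟨z | y, hz, hw⟩ := mem_frontier_subst hw
    · simp [hg hl] at hw
    · have h0 := h₁ j hj
      have : y ∈ (ts j).frontier.filterMap Sum.getRight? := List.mem_filterMap.2 ⟨_, hz, rfl⟩
      simp only [Function.comp_apply] at h0
      simp [h0] at this

theorem exists_flatten_ofFn {α : Type} :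
    ∀ {n : ℕ} (v : List α) (len : Fin n → ℕ), v.length = ∑ i, len i →
      ∃ L : Fin n → List α, v = (List.ofFn L).flatten ∧ ∀ i, (L i).length = len i
  | 0, v, len, h => ⟨Fin.elim0, by simpa using h, fun i => i.elim0⟩
  | n + 1, v, len, h => by
    rw [Fin.sum_univ_succ] at h
    obtain ⟨L, h₁, h₂⟩ := exists_flatten_ofFn (v.drop (len 0)) (fun i => len i.succ)
      (by simp [h])
    refine ⟨Fin.cons (v.take (len 0)) L, ?_, ?_⟩
    · simp [List.ofFn_succ, ← h₁]
    · intro i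
      cases i using Fin.cases with
      | zero => simp [h]
      | succ i => simp [h₂]

theorem flatten_ofFn_inj {α : Type} :
    ∀ {n : ℕ} {L L' : Fin n → List α}, (List.ofFn L).flatten = (List.ofFn L').flatten →
      (∀ i, (L i).length = (L' i).length) → ∀ i, L i = L' i
  | 0, _, _, _, _, i => i.elim0
  | n + 1, L, L', h, hl, i => by
    rw [List.ofFn_succ, List.ofFn_succ, List.flatten_cons, List.flatten_cons] at h
    obtain ⟨h₀, h₁⟩ := List.append_inj h (hl 0)
    cases i using Fin.cases with
    | zero => exact h₀
    | succ i => exact flatten_ofFn_inj h₁ (fun i => hl i.succ) i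

/-- Keeps the shape of the tree and renames its leaves from left to right. With the variables as new
labels, this turns a configuration into a context. -/
theorem exists_relabel :
    ∀ (ζ : RTree S H) (v : List H'), v.length = ζ.frontier.length →
      ∃ C : RTree S H', C.frontier = v ∧
        ∀ f : H' → RTree S H, v.map f = ζ.frontier.map leaf → C.subst f = ζ
  | leaf h, v, hv => by
    obtain ⟨x, rfl⟩ := List.length_eq_one_iff.1 hv
    refine ⟨leaf x, rfl, fun f hf => ?_⟩
    simpa [frontier, subst] using hf
  | node s ts, v, hv => by
    obtain ⟨L, rfl, hL⟩ := exists_flatten_ofFn v (fun i => (ts i).frontier.length)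
      (by rw [hv, frontier, List.length_flatten, List.map_ofFn, List.sum_ofFn]; rfl)
    choose C hC hf using fun i => exists_relabel (ts i) (L i) (hL i)
    refine ⟨node s C, by simp [frontier, hC], fun f h => ?_⟩
    simp only [frontier, List.map_flatten, List.map_ofFn] at h
    simp only [subst]
    congr 1
    funext i
    exact hf i f (flatten_ofFn_inj h (by simp [hL]) i)

theorem exists_context_of_repl {h : H} {t ζ ζ' : RTree S H} (r : Repl True h t ζ ζ') :
    ∃ (k : ℕ) (C : RTree S (Empty ⊕ Fin (k + 1))) (qs : Fin k → H), C.IsContext ∧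
      ζ = C.subst (Sum.elim Empty.elim (Fin.cons (leaf h) fun i => leaf (qs i))) ∧
      ζ' = C.subst (Sum.elim Empty.elim (Fin.cons t fun i => leaf (qs i))) := by
  have hd : ∃ rest, ζ.frontier = h :: rest := by
    induction r with
    | leaf => exact ⟨[], rfl⟩
    | node s ts i t' hi _ ih =>
      obtain ⟨r, hr⟩ := ih
      rw [frontier]
      rcases e : (List.ofFn fun i => (ts i).frontier).flatten with _ | ⟨x, rest⟩
      · simp only [List.flatten_eq_nil_iff, List.mem_ofFn] at e
        simpa [hr] using e _ ⟨i, rfl⟩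
      · obtain ⟨i', r', h₁, h₂, -⟩ := flatten_ofFn_eq_cons e
        rcases lt_trichotomy i i' with hlt | rfl | hlt
        · simpa [hr] using h₁ i hlt
        · rw [hr] at h₂
          exact ⟨rest, by rw [(List.cons.inj h₂).1]⟩
        · simp [hi trivial i' hlt] at h₂
  obtain ⟨rest, hrest⟩ := hd
  obtain ⟨C, hC, hf⟩ := exists_relabel (H' := Empty ⊕ Fin (rest.length + 1)) ζ
    ((List.finRange (rest.length + 1)).map Sum.inr) (by simp [hrest])
  have hctx : C.frontier.filterMap Sum.getRight? = List.finRange (rest.length + 1) := by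
    rw [hC, List.filterMap_map]
    exact List.filterMap_some
  have e := hf (Sum.elim Empty.elim (Fin.cons (leaf h) fun i => leaf (rest.get i))) (by
    rw [hrest, List.map_map, Sum.elim_comp_inr, List.finRange_succ]
    simp only [List.map_cons, List.map_map, Fin.cons_zero, List.cons.injEq, true_and]
    rw [← List.ofFn_eq_map, ← List.ofFn_get rest, List.map_ofFn]
    simp [Function.comp_def])
  -- The context was built from `ζ` alone; that it also yields `ζ'` follows because leftmost
  -- replacement is deterministic.
  refine ⟨rest.length, C, rest.get, hctx, e.symm, r.unique ?_⟩
  have := repl_of_frontier (S := S) (K := Empty) (l := True) (g := Empty.elim)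
    (f := Fin.cons (leaf h) fun i => leaf (rest.get i))
    (f' := Fin.cons t fun i => leaf (rest.get i)) (fun _ z => z.elim) (x := 0) rfl
    (fun y hy => by obtain ⟨y, rfl⟩ := Fin.exists_succ_eq.2 hy; rfl) C _
    (hctx.trans (List.finRange_succ ..)) (by simp)
  rwa [e] at this

theorem exists_unary_context_of_repl {l : Prop} {h : H} {t ζ ζ' : RTree S H}
    (r : Repl l h t ζ ζ') :
    ∃ C : RTree S (H ⊕ Fin 1), C.IsContext ∧ ζ = C.subst (Sum.elim leaf fun _ => leaf h) ∧
      ζ' = C.subst (Sum.elim leaf fun _ => t) := by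
  -- The siblings of the path to the hole are embedded as variable-free contexts, which substitution
  -- restores.
  have hin : ∀ f : Fin 1 → RTree S H, ∀ ζ : RTree S H,
      (ζ.subst fun h => leaf (Sum.inl h)).subst (Sum.elim leaf f) = ζ := by
    intro f ζ
    induction ζ with
    | leaf h => rfl
    | node s ts ih => simp only [subst, ih]
  induction r with
  | leaf => exact ⟨leaf (.inr 0), rfl, rfl, rfl⟩
  | node s ts i t' _ _ ih =>
    obtain ⟨C, hC, e₁, e₂⟩ := ih
    refine ⟨node s (Function.update (fun j => (ts j).subst fun h => leaf (.inl h)) i C),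
      ?_, ?_, ?_⟩
    · have hj : ∀ j, j ≠ i → ((ts j).subst fun h => (leaf (.inl h) :
          RTree S (H ⊕ Fin 1))).frontier.filterMap Sum.getRight? = [] := by
        intro j _
        refine List.eq_nil_iff_forall_not_mem.2 fun x hx => ?_
        obtain ⟨z, hz, hx⟩ := List.mem_filterMap.1 hx
        obtain ⟨w, _, hz⟩ := mem_frontier_subst hz
        simp only [frontier, List.mem_singleton] at hz
        simp [hz] at hx
      unfold IsContext at hC ⊢
      rw [frontier, List.filterMap_flatten, List.map_ofFn]
      have : (List.filterMap Sum.getRight? ∘ fun j => (Function.update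
          (fun j => (ts j).subst fun h => (leaf (.inl h) : RTree S (H ⊕ Fin 1))) i C j).frontier)
          = fun j => if j = i then List.finRange 1 else [] := by
        funext j
        by_cases h : j = i
        · subst h; simp [hC]
        · simp [h, hj j h]
      rw [this]
      clear * -
      generalize S.rank s = n at i
      induction n with
      | zero => exact i.elim0
      | succ n ih =>
        rw [List.ofFn_succ]
        cases i using Fin.cases with
        | zero => simp
        | succ i =>
          have := ih i
          simp only [(Fin.succ_ne_zero _).symm, if_false, Fin.succ_inj] at this ⊢
          simpa using this
    · simp only [subst]
      congr 1
      funext j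
      by_cases h : j = i
      · subst h; simp [← e₁]
      · simp [h, hin]
    · simp only [subst]
      congr 1
      funext j
      by_cases h : j = i
      · subst h; simp [← e₂]
      · simp [h, hin]

end RTree

open RTree

variable {S : RankedAlphabet}

/-- Replaces contexts by an inductive relation, so that steps can be analysed by structural
induction. -/
theorem Transition.globalStep_iff {Q : Type} (τ : Transition S Q) (c c' : RTree S Q × ℕ) :
    τ.GlobalStep c c' ↔ Repl True τ.src (τ.target.toTree id) c.1 c'.1 ∧ τ.test.Holds c.2 ∧
      (c'.2 : ℤ) = c.2 + τ.instr := by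
  constructor
  · rintro ⟨k, C, qs, hC, e, ht, e', hm⟩
    refine ⟨?_, ht, hm⟩
    rw [e, e']
    exact repl_of_frontier (f := Fin.cons (leaf τ.src) fun i => leaf (qs i))
      (f' := Fin.cons (τ.target.toTree id) fun i => leaf (qs i)) (fun _ z => z.elim) (x := 0) rfl
      (fun y hy => by obtain ⟨y, rfl⟩ := Fin.exists_succ_eq.2 hy; rfl) C _
      (hC.trans (List.finRange_succ ..)) (by simp)
  · rintro ⟨r, ht, hm⟩
    obtain ⟨k, C, qs, hC, e, e'⟩ := exists_context_of_repl r
    exact ⟨k, C, qs, hC, e, ht, e', hm⟩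

theorem Transition.copyStep_iff {Q : Type} (τ : Transition S Q) (ζ ζ' : RTree S (Q × ℕ)) :
    τ.CopyStep ζ ζ' ↔ ∃ m m' : ℕ, τ.test.Holds m ∧ (m' : ℤ) = m + τ.instr ∧
      Repl False (τ.src, m) (τ.target.toTree fun q => (q, m')) ζ ζ' := by
  constructor
  · rintro ⟨C, m, m', hC, e, ht, hm, e'⟩
    refine ⟨m, m', ht, hm, ?_⟩
    rw [e, e']
    exact repl_of_frontier (f := fun _ => leaf (τ.src, m))
      (f' := fun _ => τ.target.toTree fun q => (q, m')) (fun h => h.elim) (x := 0) rfl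
      (fun y hy => absurd (Subsingleton.elim _ _) hy) C _
      (hC.trans (List.finRange_succ ..)) (by simp)
  · rintro ⟨m, m', ht, hm, r⟩
    obtain ⟨C, hC, e, e'⟩ := exists_unary_context_of_repl r
    exact ⟨C, m, m', hC, e, ht, hm, e'⟩

/-! ### Big-step acceptance and its equivalence with the step semantics -/

namespace GOCTA

/-- Big-step acceptance of a ground tree from a state with its own counter. -/
inductive CopyAccepts (A : GOCTA S) : A.Q → ℕ → GroundTree S → Prop
  | eps {q q' : A.Q} {p : CounterTest} {z : ℤ} {m m' : ℕ} {ξ : GroundTree S} :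
      ⟨q, p, z, .eps q'⟩ ∈ A.trans → p.Holds m → (m' : ℤ) = m + z →
      CopyAccepts A q' m' ξ → CopyAccepts A q m ξ
  | read {q : A.Q} {p : CounterTest} {z : ℤ} {m m' : ℕ} {s : S.Symb}
      {qs : Fin (S.rank s) → A.Q} {ts : Fin (S.rank s) → GroundTree S} :
      ⟨q, p, z, .read s qs⟩ ∈ A.trans → p.Holds m → (m' : ℤ) = m + z →
      (∀ i, CopyAccepts A (qs i) m' (ts i)) → CopyAccepts A q m (.node s ts)

/-- Big-step acceptance of a ground tree from a state, with the global counter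
before and after the computation. -/
inductive GlobalAccepts (A : GOCTA S) : A.Q → ℕ → GroundTree S → ℕ → Prop
  | eps {q q' : A.Q} {p : CounterTest} {z : ℤ} {m m' n : ℕ} {ξ : GroundTree S} :
      ⟨q, p, z, .eps q'⟩ ∈ A.trans → p.Holds m → (m' : ℤ) = m + z →
      GlobalAccepts A q' m' ξ n → GlobalAccepts A q m ξ n
  | read {q : A.Q} {p : CounterTest} {z : ℤ} {m : ℕ} {s : S.Symb}
      {qs : Fin (S.rank s) → A.Q} {ts : Fin (S.rank s) → GroundTree S} (c : ℕ → ℕ) :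
      ⟨q, p, z, .read s qs⟩ ∈ A.trans → p.Holds m → (c 0 : ℤ) = m + z →
      (∀ i, GlobalAccepts A (qs i) (c i) (ts i) (c (i + 1))) →
      GlobalAccepts A q m (.node s ts) (c (S.rank s))

/-- Big-step acceptance from a tree whose leaves carry states with counters. -/
def CopyDerives (A : GOCTA S) : RTree S (A.Q × ℕ) → GroundTree S → Prop
  | .leaf h, ξ => A.CopyAccepts h.1 h.2 ξ
  | .node s ts, ξ => ∃ us, ξ = .node s us ∧ ∀ i, CopyDerives A (ts i) (us i)

/-- Big-step acceptance from a tree whose leaves carry states, processed from left to right. -/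
def GlobalDerives (A : GOCTA S) : RTree S A.Q → ℕ → GroundTree S → ℕ → Prop
  | .leaf q, m, ξ, n => A.GlobalAccepts q m ξ n
  | .node s ts, m, ξ, n => ∃ (us : _) (c : ℕ → ℕ), ξ = .node s us ∧ c 0 = m ∧
      c (S.rank s) = n ∧ ∀ i, GlobalDerives A (ts i) (c i) (us i) (c (i + 1))

variable {A : GOCTA S}

theorem copyDerives_incl : ∀ ξ : GroundTree S, A.CopyDerives ξ.incl ξ
  | .node _ ts => ⟨ts, rfl, fun i => copyDerives_incl (ts i)⟩

theorem globalDerives_incl (m : ℕ) : ∀ ξ : GroundTree S, A.GlobalDerives ξ.incl m ξ m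
  | .node _ ts => ⟨ts, fun _ => m, rfl, rfl, rfl, fun i => globalDerives_incl m (ts i)⟩

theorem GlobalDerives.eq_of_frontier_eq_nil : ∀ {ζ : RTree S A.Q} {m n : ℕ} {ξ : GroundTree S},
    ζ.frontier = [] → A.GlobalDerives ζ m ξ n → m = n ∧ ζ = ξ.incl
  | .leaf _, _, _, _, h, _ => absurd h (by simp [RTree.frontier])
  | .node s ts, m, n, ξ, h, hd => by
    obtain ⟨us, c, rfl, rfl, rfl, hd⟩ := hd
    simp only [RTree.frontier, List.flatten_eq_nil_iff, List.mem_ofFn] at h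
    have hi := fun i => eq_of_frontier_eq_nil (h _ ⟨i, rfl⟩) (hd i)
    refine ⟨?_, by rw [incl_node, funext fun i => (hi i).2]⟩
    have key : ∀ k ≤ S.rank s, c 0 = c k := by
      intro k
      induction k with
      | zero => exact fun _ => rfl
      | succ k ih => exact fun hk => (ih (by omega)).trans (hi ⟨k, hk⟩).1
    exact key _ le_rfl

/-- Backward closure under steps: a computation is turned into big-step acceptance by induction from
its end, where the ground tree derives itself. -/
theorem copyDerives_of_step {ζ ζ' : RTree S (A.Q × ℕ)} {ξ : GroundTree S}
    (h : A.CopyStep ζ ζ') (hd : A.CopyDerives ζ' ξ) : A.CopyDerives ζ ξ := by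
  obtain ⟨⟨q, p, z, tgt⟩, hτ, h⟩ := h
  obtain ⟨m, m', ht, hm, r⟩ := (Transition.copyStep_iff _ _ _).1 h
  clear h
  dsimp only at ht hm r
  induction r generalizing ξ with
  | leaf =>
    cases tgt with
    | eps q' => exact .eps hτ ht hm hd
    | read s qs =>
      obtain ⟨us, rfl, hd⟩ := hd
      exact .read hτ ht hm hd
  | node s ts i t' _ r ih =>
    obtain ⟨us, rfl, hd⟩ := hd
    refine ⟨us, rfl, fun j => ?_⟩
    have := hd j
    by_cases hj : j = i
    · subst hj
      rw [Function.update_self] at this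
      exact ih this
    · rwa [Function.update_of_ne hj] at this

theorem globalDerives_of_step {ζ ζ' : RTree S A.Q} {m m' n : ℕ} {ξ : GroundTree S}
    (h : A.GlobalStep (ζ, m) (ζ', m')) (hd : A.GlobalDerives ζ' m' ξ n) :
    A.GlobalDerives ζ m ξ n := by
  obtain ⟨⟨q, p, z, tgt⟩, hτ, h⟩ := h
  obtain ⟨r, ht, hm⟩ := (Transition.globalStep_iff _ _ _).1 h
  clear h
  dsimp only at ht hm r
  induction r generalizing ξ n with
  | leaf =>
    cases tgt with
    | eps q' => exact .eps hτ ht hm hd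
    | read s qs =>
      obtain ⟨us, c, rfl, rfl, rfl, hd⟩ := hd
      exact .read c hτ ht hm hd
  | node s ts i t' hi r ih =>
    obtain ⟨us, c, rfl, h0, hn, hd⟩ := hd
    have hc : ∀ k ≤ i.1, c k = m' := by
      intro k
      induction k with
      | zero => exact fun _ => h0
      | succ k ihk =>
        intro hk
        have hlt : (⟨k, by omega⟩ : Fin (S.rank s)) < i := hk
        have := hd ⟨k, by omega⟩
        rw [Function.update_of_ne hlt.ne] at this
        exact (GlobalDerives.eq_of_frontier_eq_nil (hi trivial _ hlt) this).1.symm.trans (ihk (by omega))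
    -- Children left of `i` carry no state, so they leave the counter unchanged; before the step it
    -- reads `m` up to the entry of child `i`.
    refine ⟨us, fun k => if k ≤ i.1 then m else c k, rfl, by simp, ?_, fun j => ?_⟩
    · simpa [not_le.2 i.2] using hn
    · have := hd j
      rcases lt_trichotomy j i with hj | rfl | hj
      · rw [Function.update_of_ne hj.ne] at this
        have hj' : j.1 < i.1 := hj
        simp only [if_pos hj'.le, if_pos (Nat.succ_le_of_lt hj')]
        rw [(GlobalDerives.eq_of_frontier_eq_nil (hi trivial _ hj) this).2]
        exact globalDerives_incl m _
      · rw [Function.update_self, hc _ le_rfl] at this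
        simpa using ih this
      · rw [Function.update_of_ne hj.ne'] at this
        have hj' : i.1 < j.1 := hj
        simpa [not_le.2 hj', not_le.2 (Nat.lt_succ_of_lt hj')] using this

theorem CopyAccepts.of_reflTransGen {q : A.Q} {m : ℕ} {ξ : GroundTree S}
    (h : Relation.ReflTransGen A.CopyStep (.leaf (q, m)) ξ.incl) : A.CopyAccepts q m ξ := by
  suffices ∀ ζ, Relation.ReflTransGen A.CopyStep ζ ξ.incl → A.CopyDerives ζ ξ from this _ h
  intro ζ h
  induction h using Relation.ReflTransGen.head_induction_on with
  | refl => exact copyDerives_incl ξ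
  | head h _ ih => exact copyDerives_of_step h ih

theorem GlobalAccepts.of_reflTransGen {q : A.Q} {m n : ℕ} {ξ : GroundTree S}
    (h : Relation.ReflTransGen A.GlobalStep (.leaf q, m) (ξ.incl, n)) :
    A.GlobalAccepts q m ξ n := by
  suffices ∀ c, Relation.ReflTransGen A.GlobalStep c (ξ.incl, n) →
    A.GlobalDerives c.1 c.2 ξ n from this _ h
  intro c h
  induction h using Relation.ReflTransGen.head_induction_on with
  | refl => exact globalDerives_incl n ξ
  | head h _ ih => exact globalDerives_of_step h ih

theorem CopyAccepts.reflTransGen {q : A.Q} {m : ℕ} {ξ : GroundTree S}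
    (h : A.CopyAccepts q m ξ) : Relation.ReflTransGen A.CopyStep (.leaf (q, m)) ξ.incl := by
  induction h with
  | eps hτ ht hm _ ih =>
    exact .head ⟨_, hτ, (Transition.copyStep_iff _ _ _).2 ⟨_, _, ht, hm, .leaf⟩⟩ ih
  | @read q p z m m' s qs ts hτ ht hm _ ih =>
    refine .head (b := .node s fun i => .leaf (qs i, m'))
      ⟨_, hτ, (Transition.copyStep_iff _ _ _).2 ⟨_, _, ht, hm, .leaf⟩⟩ ?_
    -- The children are completed one at a time; after `k` rounds the first `k` are ground.
    have key : ∀ k ≤ S.rank s, Relation.ReflTransGen A.CopyStep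
        (.node s fun i => .leaf (qs i, m'))
        (.node s fun i => if i.1 < k then (ts i).incl else .leaf (qs i, m')) := by
      intro k
      induction k with
      | zero => exact fun _ => by simpa using .refl
      | succ k ihk =>
        intro hk
        refine (ihk (by omega)).trans ?_
        let w : Fin (S.rank s) → RTree S (A.Q × ℕ) :=
          fun i => if i.1 < k then (ts i).incl else .leaf (qs i, m')
        have hstep : ∀ t t', A.CopyStep t t' → A.CopyStep
            (.node s (Function.update w ⟨k, hk⟩ t)) (.node s (Function.update w ⟨k, hk⟩ t')) := by
            intro t t' h
            obtain ⟨τ, hτ, h⟩ := h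
            obtain ⟨m, m', ht, hm, r⟩ := (Transition.copyStep_iff _ _ _).1 h
            refine ⟨τ, hτ, (Transition.copyStep_iff _ _ _).2 ⟨m, m', ht, hm, ?_⟩⟩
            have := Repl.node (l := False) s (Function.update w ⟨k, hk⟩ t) ⟨k, hk⟩ t'
              (fun h => h.elim) (by simpa using r)
            rwa [Function.update_idem] at this
        have : Relation.ReflTransGen A.CopyStep
            (.node s (Function.update w ⟨k, hk⟩ (.leaf (qs ⟨k, hk⟩, m'))))
            (.node s (Function.update w ⟨k, hk⟩ (ts ⟨k, hk⟩).incl)) :=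
          (ih ⟨k, hk⟩).lift (fun t => RTree.node s (Function.update w ⟨k, hk⟩ t)) hstep
        convert this using 2
        · funext i
          by_cases h : i = ⟨k, hk⟩
          · subst h; simp
          · simp [h, w]
        · funext i
          by_cases h : i = ⟨k, hk⟩
          · subst h; simp
          · have : i.1 ≠ k := fun e => h (Fin.ext e)
            simp [h, w, show i.1 < k + 1 ↔ i.1 < k by omega]
    simpa [incl_node] using key _ le_rfl

theorem GlobalAccepts.reflTransGen {q : A.Q} {m n : ℕ} {ξ : GroundTree S}
    (h : A.GlobalAccepts q m ξ n) :
    Relation.ReflTransGen A.GlobalStep (.leaf q, m) (ξ.incl, n) := by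
  induction h with
  | eps hτ ht hm _ ih =>
    exact .head ⟨_, hτ, (Transition.globalStep_iff _ _ (_, _)).2 ⟨.leaf, ht, hm⟩⟩ ih
  | @read q p z m s qs ts c hτ ht hm _ ih =>
    refine .head (b := (.node s fun i => .leaf (qs i), c 0))
      ⟨_, hτ, (Transition.globalStep_iff _ _ _).2 ⟨.leaf, ht, hm⟩⟩ ?_
    -- Here the left-to-right order is forced: child `k` may be rewritten only because all children
    -- before it are already ground.
    have key : ∀ k ≤ S.rank s, Relation.ReflTransGen A.GlobalStep
        (.node s fun i => .leaf (qs i), c 0)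
        (.node s fun i => if i.1 < k then (ts i).incl else .leaf (qs i), c k) := by
      intro k
      induction k with
      | zero => exact fun _ => by simpa using .refl
      | succ k ihk =>
        intro hk
        refine (ihk (by omega)).trans ?_
        let w : Fin (S.rank s) → RTree S A.Q :=
          fun i => if i.1 < k then (ts i).incl else .leaf (qs i)
        have hstep : ∀ t t' : RTree S A.Q × ℕ, A.GlobalStep t t' → A.GlobalStep
            (.node s (Function.update w ⟨k, hk⟩ t.1), t.2)
            (.node s (Function.update w ⟨k, hk⟩ t'.1), t'.2) := by
            intro t t' h
            obtain ⟨τ, hτ, h⟩ := h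
            obtain ⟨r, ht, hm⟩ := (Transition.globalStep_iff _ _ _).1 h
            refine ⟨τ, hτ, (Transition.globalStep_iff _ _ _).2 ⟨?_, ht, hm⟩⟩
            have := Repl.node (l := True) s (Function.update w ⟨k, hk⟩ t.1) ⟨k, hk⟩ t'.1
              (fun _ j hj => by
                have hj' : j.1 < k := hj
                rw [Function.update_of_ne hj.ne]
                simp [w, hj', frontier_incl]) (by simpa using r)
            rwa [Function.update_idem] at this
        have : Relation.ReflTransGen A.GlobalStep
            (.node s (Function.update w ⟨k, hk⟩ (.leaf (qs ⟨k, hk⟩))), c k)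
            (.node s (Function.update w ⟨k, hk⟩ (ts ⟨k, hk⟩).incl), c (k + 1)) :=
          (ih ⟨k, hk⟩).lift
            (fun t => (RTree.node s (Function.update w ⟨k, hk⟩ t.1), t.2)) hstep
        convert this using 3
        · funext i
          by_cases h : i = ⟨k, hk⟩
          · subst h; simp
          · simp [h, w]
        · funext i
          by_cases h : i = ⟨k, hk⟩
          · subst h; simp
          · have : i.1 ≠ k := fun e => h (Fin.ext e)
            simp [h, w, show i.1 < k + 1 ↔ i.1 < k by omega]
    simpa [incl_node] using key _ le_rfl

theorem mem_copyLanguage {ξ : GroundTree S} :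
    ξ ∈ A.copyLanguage ↔ A.CopyAccepts A.init 0 ξ :=
  ⟨.of_reflTransGen, CopyAccepts.reflTransGen⟩

theorem mem_language {ξ : GroundTree S} :
    ξ ∈ A.language ↔ ∃ n, A.GlobalAccepts A.init 0 ξ n :=
  exists_congr fun _ => ⟨.of_reflTransGen, GlobalAccepts.reflTransGen⟩

/-- Cut and paste at the root: past the initial ε-transitions, a child matters only through the
state and the counter from which it is accepted. -/
theorem CopyAccepts.exists_read {q : A.Q} {m : ℕ} {s : S.Symb}
    {ts : Fin (S.rank s) → GroundTree S} (h : A.CopyAccepts q m (.node s ts)) :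
    ∃ (qs : Fin (S.rank s) → A.Q) (m' : ℕ), (∀ i, A.CopyAccepts (qs i) m' (ts i)) ∧
      ∀ us : Fin (S.rank s) → GroundTree S, (∀ i, A.CopyAccepts (qs i) m' (us i)) → A.CopyAccepts q m (.node s us) := by
  generalize e : RTree.node s ts = ξ at h
  induction h with
  | eps hτ ht hm _ ih =>
    obtain ⟨qs, m', h₁, h₂⟩ := ih e
    exact ⟨qs, m', h₁, fun us hu => .eps hτ ht hm (h₂ us hu)⟩
  | read hτ ht hm h =>
    cases e
    exact ⟨_, _, h, fun us hu => .read hτ ht hm hu⟩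

/-- The global form of cut and paste fixes only the counter at the entry of the first child; the
later values `c'` may differ from `c`. -/
theorem GlobalAccepts.exists_read {q : A.Q} {m n : ℕ} {s : S.Symb}
    {ts : Fin (S.rank s) → GroundTree S} (h : A.GlobalAccepts q m (.node s ts) n) :
    ∃ (qs : Fin (S.rank s) → A.Q) (c : ℕ → ℕ), c (S.rank s) = n ∧
      (∀ i : Fin (S.rank s), A.GlobalAccepts (qs i) (c i) (ts i) (c (i + 1))) ∧
      ∀ (us : Fin (S.rank s) → GroundTree S) (c' : ℕ → ℕ), c' 0 = c 0 →
        (∀ i : Fin (S.rank s), A.GlobalAccepts (qs i) (c' i) (us i) (c' (i + 1))) →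
        A.GlobalAccepts q m (.node s us) (c' (S.rank s)) := by
  generalize e : RTree.node s ts = ξ at h
  induction h with
  | eps hτ ht hm _ ih =>
    obtain ⟨qs, c, h₀, h₁, h₂⟩ := ih e
    exact ⟨qs, c, h₀, h₁, fun us c' hc hu => .eps hτ ht hm (h₂ us c' hc hu)⟩
  | read c hτ ht hm h =>
    cases e
    exact ⟨_, c, rfl, h, fun us c' hc hu => .read c' hτ ht (by rw [hc, hm]) hu⟩

end GOCTA

/-! ### Pumping for one-counter systems -/

/-- Runs of a one-counter system with states `P`, transition relation `R`, and labels in `M`. -/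
inductive CounterRun {P M : Type} [AddCommMonoid M] (R : P → CounterTest → ℤ → M → P → Prop) :
    P → ℕ → M → P → ℕ → Prop
  | refl (p : P) (m : ℕ) : CounterRun R p m 0 p m
  | step {p p' f : P} {t : CounterTest} {z : ℤ} {x y : M} {m m' n : ℕ} :
      R p t z x p' → t.Holds m → (m' : ℤ) = m + z → CounterRun R p' m' y f n →
      CounterRun R p m (x + y) f n

/-- The run given by the configurations `st i`, `c i` for `i ≤ T`, where the counter is
positive before each step. -/
structure PosRun {P M : Type} (R : P → CounterTest → ℤ → M → P → Prop) (T : ℕ)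
    (st : ℕ → P) (c : ℕ → ℕ) (lab : ℕ → M) : Prop where
  pos : ∀ i < T, 1 ≤ c i
  step : ∀ i < T, ∃ t z, R (st i) t z (lab i) (st (i + 1)) ∧ t.Holds (c i) ∧
    (c (i + 1) : ℤ) = c i + z

variable {P M : Type} {R : P → CounterTest → ℤ → M → P → Prop}

/-- The first time at which the counter is at most `v`. -/
theorem PosRun.exists_first_le {Z T : ℕ} {st : ℕ → P} {c : ℕ → ℕ} {lab : ℕ → M}
    (hZ : ∀ p t z x p', R p t z x p' → |z| ≤ Z) (h : PosRun R T st c lab) (hT : c T = 0)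
    (v : ℕ) (hv : v ≤ c 0) : ∃ i ≤ T, c i ≤ v ∧ v < c i + (Z + 1) ∧ ∀ j < i, v < c j := by
  have hex : ∃ i, c i ≤ v := ⟨T, by omega⟩
  classical
  refine ⟨Nat.find hex, Nat.find_min' hex (by omega), Nat.find_spec hex, ?_,
    fun j hj => not_le.1 (Nat.find_min hex hj)⟩
  rcases e : Nat.find hex with _ | i
  · omega
  -- The value just before the first passage exceeds `v`, and one step lowers it by at most `Z`.
  · have h1 : v < c i := not_le.1 (Nat.find_min hex (by omega))
    have h2 : i < T := by
      have := Nat.find_min' hex (show c T ≤ v by omega)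
      omega
    obtain ⟨t, z, hR, -, hc⟩ := h.step i h2
    have := abs_le.1 (hZ _ _ _ _ _ hR)
    omega

/-- Pigeonhole on the first passages below the `|P| + 1` levels `c 0 - k * (Z + 1)`. The spacing `Z
+ 1` exceeds the overshoot, so the counters at distinct levels strictly decrease. -/
theorem PosRun.exists_loop [Finite P] {Z T : ℕ} {st : ℕ → P} {c : ℕ → ℕ} {lab : ℕ → M}
    (hZ : ∀ p t z x p', R p t z x p' → |z| ≤ Z) (h : PosRun R T st c lab) (hT : c T = 0)
    (h0 : Nat.card P * (Z + 1) ≤ c 0) :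
    ∃ i l, i + l ≤ T ∧ st (i + l) = st i ∧ c (i + l) < c i ∧
      c i ≤ c (i + l) + (Nat.card P + 1) * (Z + 1) := by
  have hk : ∀ k : Fin (Nat.card P + 1), k * (Z + 1) ≤ c 0 := fun k =>
    le_trans (Nat.mul_le_mul_right _ (Nat.lt_succ_iff.1 k.2)) h0
  choose τ hτ h₁ h₂ h₃ using fun k : Fin (Nat.card P + 1) =>
    h.exists_first_le hZ hT (c 0 - k * (Z + 1)) (Nat.sub_le _ _)
  have : ¬ Function.Injective fun k => st (τ k) := by
    intro hinj
    have := Nat.card_le_card_of_injective _ hinj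
    simp at this
  simp only [Function.Injective, not_forall] at this
  obtain ⟨a, b, hab, hne⟩ := this
  wlog hlt : a < b generalizing a b
  · exact this b a hab.symm (Ne.symm hne) (lt_of_le_of_ne (not_lt.1 hlt) (Ne.symm hne))
  have hmul : a * (Z + 1) + (Z + 1) ≤ b * (Z + 1) := by
    rw [← Nat.succ_mul]; exact Nat.mul_le_mul_right _ hlt
  have hb := hk b
  have hb' : b * (Z + 1) + (Z + 1) ≤ (Nat.card P + 1) * (Z + 1) := by
    rw [← Nat.succ_mul]; exact Nat.mul_le_mul_right _ b.2
  have := h₁ a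
  have := h₁ b
  have := h₂ a
  have := h₂ b
  have hle : τ a ≤ τ b := by
    by_contra hcon
    have := h₃ a (τ b) (by omega)
    omega
  refine ⟨τ a, τ b - τ a, ?_, ?_, ?_, ?_⟩ <;> rw [Nat.add_sub_cancel' hle]
  · exact hτ b
  · exact hab.symm
  · omega
  · omega

variable [AddCommMonoid M]

theorem CounterTest.Holds.add {t : CounterTest} {m : ℕ} (h : t.Holds m) (hm : 1 ≤ m) (k : ℕ) :
    t.Holds (m + k) := by
  cases t with
  | zero => exact absurd (show m = 0 from h) (by omega)
  | pos => exact Nat.le_add_right_of_le hm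
  | top => trivial

theorem CounterRun.of_eq {p f : P} {m n : ℕ} {x y : M} (h : CounterRun R p m x f n)
    (e : x = y) : CounterRun R p m y f n := e ▸ h

theorem CounterRun.trans {p q f : P} {m k n : ℕ} {x y : M} (h : CounterRun R p m x q k)
    (h' : CounterRun R q k y f n) : CounterRun R p m (x + y) f n := by
  induction h with
  | refl => rwa [zero_add]
  | step hR ht hm _ ih => rw [add_assoc]; exact .step hR ht hm (ih h')

/-- A segment of a run with positive counter values, with all counter values raised by `k`. -/
theorem PosRun.counterRun {T : ℕ} {st : ℕ → P} {c : ℕ → ℕ} {lab : ℕ → M}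
    (h : PosRun R T st c lab) (k i : ℕ) :
    ∀ l, i + l ≤ T → CounterRun R (st i) (c i + k) (∑ a ∈ Finset.range l, lab (i + a))
      (st (i + l)) (c (i + l) + k) := by
  intro l
  induction l with
  | zero => intro _; simpa using .refl _ _
  | succ l ih =>
    intro hl
    obtain ⟨t, z, hR, ht, hc⟩ := h.step (i + l) (by omega)
    rw [Finset.sum_range_succ]
    refine (ih (by omega)).trans ?_
    rw [← add_zero (lab (i + l))]
    exact .step hR (ht.add (h.pos _ (by omega)) k) (by rw [← add_assoc]; push_cast; omega)
      (.refl _ _)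

/-- A run either never uses a zero counter, or it has a maximal such part ending at zero. -/
theorem CounterRun.exists_posRun {p f : P} {m n : ℕ} {x : M} (h : CounterRun R p m x f n) :
    ∃ T st c lab, PosRun R T st c lab ∧ st 0 = p ∧ c 0 = m ∧
      ((st T = f ∧ x = ∑ a ∈ Finset.range T, lab a) ∨
        (c T = 0 ∧ ∃ y, x = ∑ a ∈ Finset.range T, lab a + y ∧ CounterRun R (st T) 0 y f n)) := by
  induction h with
  | refl p m =>
    exact ⟨0, fun _ => p, fun _ => m, fun _ => 0, ⟨by simp, by simp⟩, rfl, rfl, .inl ⟨rfl, by simp⟩⟩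
  | @step p p' f t z x y m m' n hR ht hm hr ih =>
    rcases Nat.eq_zero_or_pos m with rfl | hpos
    · exact ⟨0, fun _ => p, fun _ => 0, fun _ => 0, ⟨by simp, by simp⟩, rfl, rfl,
        .inr ⟨rfl, x + y, by simp, .step hR ht hm hr⟩⟩
    · obtain ⟨T, st, c, lab, h, h₀, h₁, h₂⟩ := ih
      refine ⟨T + 1, fun i => i.casesOn p st, fun i => i.casesOn m c,
        fun i => i.casesOn x lab, ⟨?_, ?_⟩, rfl, rfl, ?_⟩
      · rintro (_ | i) hi
        · exact hpos
        · exact h.pos i (by omega)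
      · rintro (_ | i) hi
        · exact ⟨t, z, by simpa [h₀] using hR, ht, by simpa [h₁] using hm⟩
        · exact h.step i (by omega)
      · simp only [Finset.sum_range_succ']
        rcases h₂ with ⟨h₂, rfl⟩ | ⟨h₂, y, rfl, h₃⟩
        · exact .inl ⟨h₂, add_comm _ _⟩
        · exact .inr ⟨h₂, y, by rw [← add_assoc, add_comm x]; rfl, h₃⟩

/-- The loop between two visits of the same state can be repeated, starting at a higher
counter value. -/
theorem CounterRun.pump {s : P} {δ : M} {j g : ℕ}
    (h : ∀ e, CounterRun R s (j + g + e) δ s (j + e)) (k : ℕ) :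
    CounterRun R s (j + g + k * g) (k • δ) s (j + g) := by
  induction k with
  | zero => simpa using .refl _ _
  | succ k ih =>
    have := (h ((k + 1) * g)).trans (x := δ) (y := k • δ)
      (by rwa [show j + (k + 1) * g = j + g + k * g by ring])
    rwa [succ_nsmul']

/-- Pumping for one-counter systems: a run from a large counter value contains a loop of bounded
drop that can be repeated if one starts with a counter value raised accordingly. -/
theorem CounterRun.exists_pump [Finite P] {Z : ℕ}
    (hZ : ∀ p t z x p', R p t z x p' → |z| ≤ Z) {p f : P} {m n : ℕ} {x : M}
    (h : CounterRun R p m x f n) (hm : Nat.card P * (Z + 1) ≤ m) :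
    ∃ (g : ℕ) (δ : M), 1 ≤ g ∧ g ≤ (Nat.card P + 1) * (Z + 1) ∧
      (∃ s i j, CounterRun R s i δ s j) ∧
      ∀ k, ∃ n', CounterRun R p (m + k * g) (x + k • δ) f n' := by
  obtain ⟨T, st, c, lab, hr, rfl, rfl, ⟨rfl, rfl⟩ | ⟨hT, y, rfl, hy⟩⟩ := h.exists_posRun
  -- The counter is positive before every step, so the whole run can be raised by any `k`; the empty
  -- loop serves as the witness for `δ = 0`.
  · refine ⟨1, 0, le_rfl, ?_, ⟨st 0, 0, 0, .refl _ _⟩, fun k => ⟨c T + k, ?_⟩⟩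
    · nlinarith [Nat.zero_le (Nat.card P), Nat.zero_le Z, Nat.zero_le (Nat.card P * Z)]
    · simpa using hr.counterRun k 0 T (by simp)
  · obtain ⟨i, l, hl, hs, hlt, hle⟩ := hr.exists_loop hZ hT hm
    have hloop : ∀ e, CounterRun R (st i) (c (i + l) + (c i - c (i + l)) + e)
        (∑ a ∈ Finset.range l, lab (i + a)) (st i) (c (i + l) + e) := fun e => by
      have := hr.counterRun e i l hl
      rwa [hs, show c i + e = c (i + l) + (c i - c (i + l)) + e by omega] at this
    refine ⟨c i - c (i + l), ∑ a ∈ Finset.range l, lab (i + a), by omega, by omega,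
      ⟨st i, _, _, hloop 0⟩, fun k => ⟨n, ?_⟩⟩
    -- The raised prefix reaches the loop `k * g` too high, `k` inserted loops come down to `c i`,
    -- and the rest is the original run, including its own pass through the loop.
    have hpre := hr.counterRun (k * (c i - c (i + l))) 0 i (by omega)
    have hmid := CounterRun.pump hloop k
    have hpost := hr.counterRun 0 i (T - i) (by omega)
    simp only [zero_add, add_zero] at hpre hpost
    rw [show i + (T - i) = T by omega, hT] at hpost
    rw [show c (i + l) + (c i - c (i + l)) = c i by omega] at hmid
    have e : ∑ a ∈ Finset.range T, lab a =
        ∑ a ∈ Finset.range i, lab a + ∑ a ∈ Finset.range (T - i), lab (i + a) := by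
      rw [← Finset.sum_range_add, show i + (T - i) = T by omega]
    have := ((hpre.trans hmid).trans hpost).trans hy
    rw [e]
    convert this using 1
    abel

/-- Among the pairs `f n`, infinitely many distinct ones share a colour and a residue of
the counter value, and these counter values are unbounded. -/
theorem exists_frequent_color {C : Type} [Finite C] (G : ℕ) [NeZero G] {f : ℕ → C × ℕ}
    (hf : Function.Injective f) :
    ∃ (col : C) (ρ : ZMod G), ∀ B, ∃ n, B ≤ (f n).2 ∧ (f n).1 = col ∧ ((f n).2 : ZMod G) = ρ := by
  obtain ⟨⟨col, ρ⟩, h⟩ := Finite.exists_infinite_fiber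
    fun n => ((f n).1, ((f n).2 : ZMod G))
  refine ⟨col, ρ, fun B => ?_⟩
  -- If the counters in the infinite fibre were bounded, injectivity would make the fibre finite.
  by_contra! hcon
  refine (Set.infinite_coe_iff.1 h) (Set.Finite.subset
    (((Set.finite_singleton col).prod (Set.finite_lt_nat B)).preimage hf.injOn) ?_)
  intro n hn
  simp only [Set.mem_preimage, Set.mem_singleton_iff, Prod.mk.injEq] at hn
  refine ⟨hn.1, ?_⟩
  by_contra hB
  exact hcon n (not_lt.1 hB) hn.1 hn.2

/-- Applied with `G = B!`, so that residues can be fixed before the loop drop `g ≤ B` is known. -/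
theorem exists_eq_add_mul {G g a b : ℕ} (hg : g ∣ G) (hab : a < b)
    (h : (a : ZMod G) = b) : ∃ k, 1 ≤ k ∧ b = a + k * g := by
  have h1 := (Nat.modEq_iff_dvd' hab.le).1 ((ZMod.natCast_eq_natCast_iff _ _ _).1 h)
  obtain ⟨k, hk⟩ := hg.trans h1
  refine ⟨k, Nat.pos_of_ne_zero ?_, by rw [mul_comm, ← hk]; omega⟩
  rintro rfl
  omega

theorem GOCTA.exists_instr_bound {S : RankedAlphabet} (A : GOCTA S) :
    ∃ Z : ℕ, ∀ τ ∈ A.trans, |τ.instr| ≤ Z := by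
  obtain ⟨Z, hZ⟩ := (A.finite_trans.image fun τ => τ.instr.natAbs).bddAbove
  refine ⟨Z, fun τ hτ => ?_⟩
  have := hZ ⟨τ, hτ, rfl⟩
  rw [Int.abs_eq_natAbs]
  exact_mod_cast this

theorem GOCTA.GlobalAccepts.read_unary {S : RankedAlphabet} {A : GOCTA S} {q : A.Q}
    {p : CounterTest} {z : ℤ} {m m' n : ℕ} {s : S.Symb} {qs : Fin (S.rank s) → A.Q}
    {ts : Fin (S.rank s) → GroundTree S} (hs : S.rank s = 1)
    (hτ : ⟨q, p, z, .read s qs⟩ ∈ A.trans) (hp : p.Holds m) (hm : (m' : ℤ) = m + z)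
    (h : ∀ i, A.GlobalAccepts (qs i) m' (ts i) n) : A.GlobalAccepts q m (.node s ts) n := by
  have := GOCTA.GlobalAccepts.read (fun i => if i = 0 then m' else n) hτ hp (by simpa using hm)
    (ts := ts) (fun i => by simpa [show i.1 = 0 by omega] using h i)
  simpa [hs] using this

theorem GOCTA.GlobalAccepts.read_nullary {S : RankedAlphabet} {A : GOCTA S} {q : A.Q}
    {p : CounterTest} {z : ℤ} {m m' : ℕ} {s : S.Symb} {qs : Fin (S.rank s) → A.Q}
    {ts : Fin (S.rank s) → GroundTree S} (hs : S.rank s = 0)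
    (hτ : ⟨q, p, z, .read s qs⟩ ∈ A.trans) (hp : p.Holds m) (hm : (m' : ℤ) = m + z) :
    A.GlobalAccepts q m (.node s ts) m' :=
  .read (fun _ => m') hτ hp hm (fun i => absurd i.2 (by omega))

/-! ### A global counter cannot recognize `aⁿ(σ(bⁿ#, cⁿ#))` -/

section ASigmaBC

open Trees₁

variable {A : GOCTA alphabet₁}

/-- The one-counter system that processes a tree `bⁿ#` and then, from the state `q₂`,
a tree `cⁿ#`; the labels count the symbols `b` and `c`. -/
inductive BCRel (A : GOCTA alphabet₁) (q₂ : A.Q) :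
    A.Q ⊕ Option A.Q → CounterTest → ℤ → ℕ × ℕ → A.Q ⊕ Option A.Q → Prop
  | eps_left {q t z q'} : ⟨q, t, z, .eps q'⟩ ∈ A.trans → BCRel A q₂ (.inl q) t z 0 (.inl q')
  | b {q t z} {qs : Fin 1 → A.Q} : ⟨q, t, z, .read (S := alphabet₁) Symb₁.b qs⟩ ∈ A.trans →
      BCRel A q₂ (.inl q) t z (1, 0) (.inl (qs 0))
  | hash_left {q t z} {qs : Fin 0 → A.Q} :
      ⟨q, t, z, .read (S := alphabet₁) Symb₁.hash qs⟩ ∈ A.trans →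
      BCRel A q₂ (.inl q) t z 0 (.inr (some q₂))
  | eps_right {q t z q'} : ⟨q, t, z, .eps q'⟩ ∈ A.trans →
      BCRel A q₂ (.inr (some q)) t z 0 (.inr (some q'))
  | c {q t z} {qs : Fin 1 → A.Q} : ⟨q, t, z, .read (S := alphabet₁) Symb₁.c qs⟩ ∈ A.trans →
      BCRel A q₂ (.inr (some q)) t z (0, 1) (.inr (some (qs 0)))
  | hash_right {q t z} {qs : Fin 0 → A.Q} :
      ⟨q, t, z, .read (S := alphabet₁) Symb₁.hash qs⟩ ∈ A.trans →
      BCRel A q₂ (.inr (some q)) t z 0 (.inr none)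

theorem BCRel.abs_le {q₂ : A.Q} {Z : ℕ} (hZ : ∀ τ ∈ A.trans, |τ.instr| ≤ Z) (p t z x p')
    (h : BCRel A q₂ p t z x p') : |z| ≤ Z := by
  cases h <;> exact hZ _ ‹_›

theorem counterRun_of_accepts_b (q₂ : A.Q) {q : A.Q} {m n : ℕ} {ξ : GroundTree alphabet₁}
    (h : A.GlobalAccepts q m ξ n) (k : ℕ) (hξ : ξ = b^[k] hash) :
    CounterRun (BCRel A q₂) (.inl q) m (k, 0) (.inr (some q₂)) n := by
  induction h generalizing k with
  | eps hτ ht hm _ ih =>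
    rw [← zero_add ((k, 0) : ℕ × ℕ)]
    exact .step (.eps_left hτ) ht hm (ih k hξ)
  | read c hτ ht hm _ ih =>
    cases k with
    | zero =>
      cases hξ
      rw [show ((0, 0) : ℕ × ℕ) = 0 + 0 from rfl]
      exact .step (.hash_left hτ) ht hm (.refl _ _)
    | succ k =>
      rw [Function.iterate_succ_apply'] at hξ
      cases hξ
      rw [show ((k + 1, 0) : ℕ × ℕ) = (1, 0) + (k, 0) by ext <;> simp [add_comm]]
      exact .step (.b hτ) ht hm (ih (0 : Fin 1) k rfl)

theorem counterRun_of_accepts_c (q₂ : A.Q) {q : A.Q} {m n : ℕ} {ξ : GroundTree alphabet₁}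
    (h : A.GlobalAccepts q m ξ n) (k : ℕ) (hξ : ξ = c^[k] hash) :
    CounterRun (BCRel A q₂) (.inr (some q)) m (0, k) (.inr none) n := by
  induction h generalizing k with
  | eps hτ ht hm _ ih =>
    rw [← zero_add ((0, k) : ℕ × ℕ)]
    exact .step (.eps_right hτ) ht hm (ih k hξ)
  | read c hτ ht hm _ ih =>
    cases k with
    | zero =>
      cases hξ
      rw [show ((0, 0) : ℕ × ℕ) = 0 + 0 from rfl]
      exact .step (.hash_right hτ) ht hm (.refl _ _)
    | succ k =>
      rw [Function.iterate_succ_apply'] at hξ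
      cases hξ
      rw [show ((0, k + 1) : ℕ × ℕ) = (0, 1) + (0, k) by ext <;> simp [add_comm]]
      exact .step (.c hτ) ht hm (ih (0 : Fin 1) k rfl)

/-- What a run of `BCRel` from the state `p` to the final state says about acceptance. -/
def BCAccepts (A : GOCTA alphabet₁) (q₂ : A.Q) (m : ℕ) (x : ℕ × ℕ) (n : ℕ) :
    A.Q ⊕ Option A.Q → Prop
  | .inl q => ∃ k, A.GlobalAccepts q m (b^[x.1] hash) k ∧ A.GlobalAccepts q₂ k (c^[x.2] hash) n
  | .inr (some q) => x.1 = 0 ∧ A.GlobalAccepts q m (c^[x.2] hash) n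
  | .inr none => x = 0 ∧ m = n

theorem bcAccepts_of_counterRun {q₂ : A.Q} {p f : A.Q ⊕ Option A.Q} {m n : ℕ} {x : ℕ × ℕ}
    (h : CounterRun (BCRel A q₂) p m x f n) (hf : f = .inr none) : BCAccepts A q₂ m x n p := by
  induction h with
  | refl => subst hf; exact ⟨rfl, rfl⟩
  | step hR ht hm _ ih =>
    have ih := ih hf
    cases hR with
    | eps_left hτ =>
      obtain ⟨k, h₁, h₂⟩ := ih
      rw [zero_add]
      exact ⟨k, .eps hτ ht hm h₁, h₂⟩
    | @b q t z qs hτ =>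
      obtain ⟨k, h₁, h₂⟩ := ih
      refine ⟨k, ?_, by simpa using h₂⟩
      rw [Prod.fst_add, Nat.add_comm]
      change A.GlobalAccepts _ _ (b^[_ + 1] _) _
      rw [Function.iterate_succ_apply']
      exact .read_unary rfl hτ ht hm
        (fun i => by cases Subsingleton.elim (α := Fin 1) i 0; exact h₁)
    | @hash_left q t z qs hτ =>
      obtain ⟨h₁, h₂⟩ := ih
      rw [zero_add]
      refine ⟨_, ?_, h₂⟩
      rw [h₁]
      exact .read_nullary rfl hτ ht hm
    | eps_right hτ =>
      rw [zero_add]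
      exact ⟨ih.1, .eps hτ ht hm ih.2⟩
    | c hτ =>
      obtain ⟨h₁, h₂⟩ := ih
      refine ⟨by simp [h₁], ?_⟩
      rw [Prod.snd_add, Nat.add_comm]
      change A.GlobalAccepts _ _ (c^[_ + 1] _) _
      rw [Function.iterate_succ_apply']
      exact .read_unary rfl hτ ht hm
        (fun i => by cases Subsingleton.elim (α := Fin 1) i 0; exact h₂)
    | hash_right hτ =>
      obtain ⟨rfl, rfl⟩ := ih
      exact ⟨rfl, .read_nullary rfl hτ ht hm⟩

/-- The system moves from the left side to the right and never back, reading `b` only on the left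
and `c` only on the right. Hence a loop cannot contain both symbols. -/
theorem BCRel.loop_label {q₂ : A.Q} {p p' : A.Q ⊕ Option A.Q} {m n : ℕ} {x : ℕ × ℕ}
    (h : CounterRun (BCRel A q₂) p m x p' n) :
    (p'.isLeft → x.2 = 0) ∧ (p.isRight → x.1 = 0 ∧ p'.isRight) := by
  induction h with
  | refl => simp
  | step hR _ _ _ ih => cases hR <;> simp_all

/-- Cut and paste below `aⁿσ`: the prefix fixes `q₁`, `q₂` and `k`, while the counter `l` between
the two subtrees may change. -/
theorem GOCTA.GlobalAccepts.exists_sigma (n : ℕ) {q : A.Q} {m f : ℕ} {u v : GroundTree alphabet₁}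
    (h : A.GlobalAccepts q m (a^[n] (sigma u v)) f) :
    ∃ q₁ q₂ k l, A.GlobalAccepts q₁ k u l ∧ A.GlobalAccepts q₂ l v f ∧
      ∀ u' v' l' f', A.GlobalAccepts q₁ k u' l' → A.GlobalAccepts q₂ l' v' f' →
        A.GlobalAccepts q m (a^[n] (sigma u' v')) f' := by
  induction n generalizing q m with
  | zero =>
    obtain ⟨qs, c, hf, h₁, h₂⟩ := h.exists_read
    refine ⟨qs (0 : Fin 2), qs (1 : Fin 2), c 0, c 1, h₁ (0 : Fin 2), hf ▸ h₁ (1 : Fin 2), ?_⟩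
    intro u' v' l' f' hu hv
    refine h₂ ![u', v'] (fun i => i.casesOn (c 0) fun i => i.casesOn l' fun _ => f') rfl ?_
    intro i
    change Fin 2 at i
    fin_cases i
    exacts [hu, hv]
  | succ n ih =>
    rw [Function.iterate_succ_apply'] at h
    obtain ⟨qs, c, hf, h₁, h₂⟩ := h.exists_read
    subst hf
    obtain ⟨q₁, q₂, k, l, hu, hv, H⟩ := ih (h₁ (0 : Fin 1))
    refine ⟨q₁, q₂, k, l, hu, hv, fun u' v' l' f' hu hv => ?_⟩
    rw [Function.iterate_succ_apply']
    refine h₂ (fun _ => a^[n] (sigma u' v')) (fun i => i.casesOn (c 0) fun _ => f') rfl ?_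
    intro i
    cases Subsingleton.elim (α := Fin 1) i 0
    exact H _ _ _ _ hu hv

theorem iterate_b_inj {i j : ℕ} (h : b^[i] hash = b^[j] hash) : i = j := by
  induction i generalizing j with
  | zero => cases j with
    | zero => rfl
    | succ j => rw [Function.iterate_succ_apply'] at h; cases h
  | succ i ih => cases j with
    | zero => rw [Function.iterate_succ_apply'] at h; cases h
    | succ j =>
      rw [Function.iterate_succ_apply', Function.iterate_succ_apply'] at h
      rw [ih (congrFun (eq_of_heq (RTree.node.inj h).2) (0 : Fin 1))]

theorem iterate_c_inj {i j : ℕ} (h : c^[i] hash = c^[j] hash) : i = j := by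
  induction i generalizing j with
  | zero => cases j with
    | zero => rfl
    | succ j => rw [Function.iterate_succ_apply'] at h; cases h
  | succ i ih => cases j with
    | zero => rw [Function.iterate_succ_apply'] at h; cases h
    | succ j =>
      rw [Function.iterate_succ_apply', Function.iterate_succ_apply'] at h
      rw [ih (congrFun (eq_of_heq (RTree.node.inj h).2) (0 : Fin 1))]

theorem iterate_a_inj {i j : ℕ} {u v u' v' : GroundTree alphabet₁}
    (h : a^[i] (sigma u v) = a^[j] (sigma u' v')) : i = j ∧ u = u' ∧ v = v' := by
  induction i generalizing j with
  | zero => cases j with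
    | zero =>
      have := eq_of_heq (RTree.node.inj h).2
      exact ⟨rfl, congrFun this (0 : Fin 2), congrFun this (1 : Fin 2)⟩
    | succ j => rw [Function.iterate_succ_apply'] at h; cases h
  | succ i ih => cases j with
    | zero => rw [Function.iterate_succ_apply'] at h; cases h
    | succ j =>
      rw [Function.iterate_succ_apply', Function.iterate_succ_apply'] at h
      obtain ⟨h₁, h₂⟩ := ih (congrFun (eq_of_heq (RTree.node.inj h).2) (0 : Fin 1))
      exact ⟨by rw [h₁], h₂⟩

theorem mem_langASigmaBC_iff {i j k : ℕ} :
    a^[i] (sigma (b^[j] hash) (c^[k] hash)) ∈ langASigmaBC ↔ i = j ∧ i = k := by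
  constructor
  · rintro ⟨n, h⟩
    obtain ⟨rfl, h₁, h₂⟩ := iterate_a_inj h
    exact ⟨(iterate_b_inj h₁).symm, (iterate_c_inj h₂).symm⟩
  · rintro ⟨rfl, rfl⟩
    exact ⟨i, rfl⟩

theorem not_gocta_langASigmaBC : ¬ GOCTARecognizable langASigmaBC := by
  rintro ⟨A, hA⟩
  have := A.finite_states
  obtain ⟨Z, hZ⟩ := A.exists_instr_bound
  have hex : ∀ n, ∃ q₁ q₂ k l f, A.GlobalAccepts q₁ k (b^[n] hash) l ∧
      A.GlobalAccepts q₂ l (c^[n] hash) f ∧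
      ∀ i j l' f', A.GlobalAccepts q₁ k (b^[i] hash) l' →
        A.GlobalAccepts q₂ l' (c^[j] hash) f' → n = i ∧ n = j := by
    intro n
    obtain ⟨f, hf⟩ := GOCTA.mem_language.1 (hA.symm ▸ mem_langASigmaBC_iff.2 ⟨rfl, rfl⟩ :
      a^[n] (sigma (b^[n] hash) (c^[n] hash)) ∈ A.language)
    obtain ⟨q₁, q₂, k, l, h₁, h₂, H⟩ := hf.exists_sigma
    refine ⟨q₁, q₂, k, l, f, h₁, h₂, fun i j l' f' hi hj => ?_⟩
    exact mem_langASigmaBC_iff.1 (hA ▸ GOCTA.mem_language.2 ⟨f', H _ _ _ _ hi hj⟩)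
  choose q₁ q₂ k l f hb hc H using hex
  -- Equal data for `n` and `n'` would allow `bⁿ'#` and `cⁿ'#` below `aⁿσ`.
  have hinj : Function.Injective fun n => ((q₁ n, q₂ n), k n) := by
    intro n n' h
    simp only [Prod.mk.injEq] at h
    have h₁ := hb n'
    have h₂ := hc n'
    rw [← h.1.1, ← h.2] at h₁
    rw [← h.1.2] at h₂
    exact (H n _ _ _ _ h₁ h₂).1
  -- `B` bounds both the counter needed for pumping and the drop of the loop.
  set B := (Nat.card (A.Q ⊕ Option A.Q) + 1) * (Z + 1) with hB
  have : NeZero B.factorial := ⟨B.factorial_ne_zero⟩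
  obtain ⟨⟨s₁, s₂⟩, ρ, hcol⟩ := exists_frequent_color B.factorial hinj
  obtain ⟨n, hn, hs, hρ⟩ := hcol B
  obtain ⟨n', hn', hs', hρ'⟩ := hcol (k n + 1)
  simp only [Prod.mk.injEq] at hn hs hρ hn' hs' hρ'
  have hrun := (counterRun_of_accepts_b (q₂ n) (hb n) n rfl).trans
    (counterRun_of_accepts_c (q₂ n) (hc n) n rfl)
  obtain ⟨g, δ, hg₁, hg₂, ⟨s, i, j, hloop⟩, hpump⟩ := hrun.exists_pump (BCRel.abs_le hZ)
    (le_trans (by rw [hB]; gcongr; omega) hn)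
  obtain ⟨e, he, hk⟩ := exists_eq_add_mul (Nat.dvd_factorial hg₁ hg₂) hn' (hρ.trans hρ'.symm)
  obtain ⟨m, hm⟩ := hpump e
  rw [← hk] at hm
  obtain ⟨r, h₁, h₂⟩ := bcAccepts_of_counterRun hm rfl
  -- The pumped run starts from the states and the counter of `n'`, so its two exponents must both
  -- equal `n'`.
  rw [hs.1, ← hs'.1] at h₁
  rw [hs.2, ← hs'.2] at h₂
  have h := H n' _ _ _ _ h₁ h₂
  have hδ : δ.1 = 0 ∨ δ.2 = 0 := by
    have := BCRel.loop_label hloop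
    rcases s with s | s
    · exact .inr (this.1 rfl)
    · exact .inl (this.2 rfl).1
  -- The exponent that the loop leaves alone is still `n`. This contradicts `k n < k n'`.
  have hne : n' = n := by
    rcases hδ with hδ | hδ
    · simpa [hδ] using h.1
    · simpa [hδ] using h.2
  subst hne
  omega

end ASigmaBC

/-! ### Copied counters cannot recognize `|ξ|_a = |ξ|_b` -/

section AEqB

/-- The trees over `a`, `b` and `#`. -/
def IsOverAB (ξ : GroundTree alphabet₂) : Prop :=
  ξ.IsOver ({Symb₂.a, Symb₂.b, Symb₂.hash} : Set Symb₂)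

/-- The number of symbols `a` minus the number of symbols `b`. -/
def diffAB (ξ : GroundTree alphabet₂) : ℤ :=
  ξ.count (Symb₂.a : alphabet₂.Symb) - ξ.count (Symb₂.b : alphabet₂.Symb)

/-- The tree `σ(ξ 0, ξ 1, ξ 2)`. -/
def sigma₂ (ξ : Fin 3 → GroundTree alphabet₂) : GroundTree alphabet₂ :=
  RTree.node (S := alphabet₂) Symb₂.sigma ξ

theorem isOverAB_a {ts : Fin 1 → GroundTree alphabet₂} :
    IsOverAB (RTree.node (S := alphabet₂) Symb₂.a ts) ↔ IsOverAB (ts 0) :=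
  ⟨fun h => h.2 (0 : Fin 1), fun h => ⟨.inl rfl, fun i => by
    cases Subsingleton.elim (α := Fin 1) i 0; exact h⟩⟩

theorem isOverAB_b {ts : Fin 1 → GroundTree alphabet₂} :
    IsOverAB (RTree.node (S := alphabet₂) Symb₂.b ts) ↔ IsOverAB (ts 0) :=
  ⟨fun h => h.2 (0 : Fin 1), fun h => ⟨.inr (.inl rfl), fun i => by
    cases Subsingleton.elim (α := Fin 1) i 0; exact h⟩⟩

theorem isOverAB_hash {ts : Fin 0 → GroundTree alphabet₂} :
    IsOverAB (RTree.node (S := alphabet₂) Symb₂.hash ts) :=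
  ⟨.inr (.inr rfl), fun i => Fin.elim0 i⟩

theorem not_isOverAB_sigma {ts : Fin 3 → GroundTree alphabet₂} :
    ¬ IsOverAB (RTree.node (S := alphabet₂) Symb₂.sigma ts) :=
  fun h => by simpa using (show (Symb₂.sigma ∈ ({.a, .b, .hash} : Set Symb₂)) from h.1)

/-- The contribution of a symbol to the difference of the numbers of symbols `a` and `b`. -/
def Symb₂.weight : Symb₂ → ℤ
  | .a => 1
  | .b => -1
  | _ => 0

theorem diffAB_node (s : alphabet₂.Symb) (ts : Fin (alphabet₂.rank s) → GroundTree alphabet₂) :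
    diffAB (.node s ts) = Symb₂.weight s + ∑ i, diffAB (ts i) := by
  have hs : ∀ x y : alphabet₂.Symb, x = Symb₂.a → y = Symb₂.b →
      (((if s = x then 1 else 0 : ℕ) : ℤ) - ((if s = y then 1 else 0 : ℕ) : ℤ)) =
        Symb₂.weight s := by
    rintro _ _ rfl rfl
    change Symb₂ at s
    cases s <;> rfl
  have hc : ∀ x : alphabet₂.Symb, (RTree.node s ts).count x =
      (if s = x then 1 else 0) + ∑ i, (ts i).count x := fun _ => rfl
  have key : ∀ x y : alphabet₂.Symb, x = Symb₂.a → y = Symb₂.b →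
      ((RTree.node s ts).count x : ℤ) - (RTree.node s ts).count y =
        Symb₂.weight s + ∑ i, (((ts i).count x : ℤ) - (ts i).count y) := by
    intro x y hx hy
    rw [Finset.sum_sub_distrib, ← hs x y hx hy, hc, hc]
    push_cast
    ring
  exact key _ _ rfl rfl

theorem diffAB_a (ts : Fin 1 → GroundTree alphabet₂) :
    diffAB (RTree.node (S := alphabet₂) Symb₂.a ts) = 1 + diffAB (ts 0) :=
  (diffAB_node Symb₂.a ts).trans (congrArg (1 + ·) (Fin.sum_univ_one _))

theorem diffAB_b (ts : Fin 1 → GroundTree alphabet₂) :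
    diffAB (RTree.node (S := alphabet₂) Symb₂.b ts) = -1 + diffAB (ts 0) :=
  (diffAB_node Symb₂.b ts).trans (congrArg (-1 + ·) (Fin.sum_univ_one _))

theorem diffAB_hash (ts : Fin 0 → GroundTree alphabet₂) :
    diffAB (RTree.node (S := alphabet₂) Symb₂.hash ts) = 0 :=
  (diffAB_node Symb₂.hash ts).trans (congrArg (0 + ·) (Fin.sum_univ_zero _))

theorem diffAB_sigma₂ (ts : Fin 3 → GroundTree alphabet₂) :
    diffAB (sigma₂ ts) = diffAB (ts 0) + diffAB (ts 1) + diffAB (ts 2) :=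
  (diffAB_node Symb₂.sigma ts).trans ((congrArg (0 + ·) (Fin.sum_univ_three _)).trans (zero_add _))

theorem mem_langAEqB_iff {ξ : GroundTree alphabet₂} :
    ξ ∈ langAEqB ↔ ∃ ts, ξ = sigma₂ ts ∧ (∀ i, IsOverAB (ts i)) ∧
      diffAB (ts 0) + diffAB (ts 1) + diffAB (ts 2) = 0 := by
  constructor
  · rintro ⟨⟨ξ₁, ξ₂, ξ₃, rfl, h₁, h₂, h₃⟩, h⟩
    refine ⟨![ξ₁, ξ₂, ξ₃], rfl, fun i => ?_, ?_⟩
    · fin_cases i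
      exacts [h₁, h₂, h₃]
    · rw [← diffAB_sigma₂]
      exact sub_eq_zero.2 (congrArg _ h)
  · rintro ⟨ts, rfl, h, hd⟩
    refine ⟨⟨ts 0, ts 1, ts 2, ?_, h 0, h 1, h 2⟩, ?_⟩
    · exact congrArg sigma₂ (List.ofFn_injective rfl)
    · rw [← diffAB_sigma₂] at hd
      exact_mod_cast sub_eq_zero.1 hd

theorem sigma₂_mem_langAEqB_iff {ts : Fin 3 → GroundTree alphabet₂} (h : ∀ i, IsOverAB (ts i)) :
    sigma₂ ts ∈ langAEqB ↔ diffAB (ts 0) + diffAB (ts 1) + diffAB (ts 2) = 0 := by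
  rw [mem_langAEqB_iff]
  constructor
  · rintro ⟨us, e, -, hu⟩
    cases e
    exact hu
  · exact fun hd => ⟨ts, rfl, h, hd⟩

theorem exists_diffAB_eq (x : ℤ) : ∃ ξ, IsOverAB ξ ∧ diffAB ξ = x := by
  induction x with
  | zero => exact ⟨_, isOverAB_hash (ts := Fin.elim0), diffAB_hash _⟩
  | succ n ih =>
    obtain ⟨ξ, h, hx⟩ := ih
    exact ⟨_, isOverAB_a (ts := fun _ => ξ).2 h, by rw [diffAB_a, hx, add_comm]⟩
  | pred n ih =>
    obtain ⟨ξ, h, hx⟩ := ih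
    exact ⟨_, isOverAB_b (ts := fun _ => ξ).2 h, by rw [diffAB_b, hx]; ring⟩

variable {A : GOCTA alphabet₂}

/-- The one-counter system that processes a tree over `a`, `b` and `#`; the labels give the
difference of the numbers of symbols `a` and `b`. -/
inductive ABRel (A : GOCTA alphabet₂) :
    Option A.Q → CounterTest → ℤ → ℤ → Option A.Q → Prop
  | eps {q t z q'} : ⟨q, t, z, .eps q'⟩ ∈ A.trans → ABRel A (some q) t z 0 (some q')
  | a {q t z} {qs : Fin 1 → A.Q} : ⟨q, t, z, .read (S := alphabet₂) Symb₂.a qs⟩ ∈ A.trans →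
      ABRel A (some q) t z 1 (some (qs 0))
  | b {q t z} {qs : Fin 1 → A.Q} : ⟨q, t, z, .read (S := alphabet₂) Symb₂.b qs⟩ ∈ A.trans →
      ABRel A (some q) t z (-1) (some (qs 0))
  | hash {q t z} {qs : Fin 0 → A.Q} :
      ⟨q, t, z, .read (S := alphabet₂) Symb₂.hash qs⟩ ∈ A.trans → ABRel A (some q) t z 0 none

theorem ABRel.abs_le {Z : ℕ} (hZ : ∀ τ ∈ A.trans, |τ.instr| ≤ Z) (p t z x p')
    (h : ABRel A p t z x p') : |z| ≤ Z := by
  cases h <;> exact hZ _ ‹_›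

theorem counterRun_of_copyAccepts {q : A.Q} {m : ℕ} {ξ : GroundTree alphabet₂}
    (h : A.CopyAccepts q m ξ) (hξ : IsOverAB ξ) :
    ∃ n, CounterRun (ABRel A) (some q) m (diffAB ξ) none n := by
  induction h with
  | eps hτ ht hm _ ih =>
    obtain ⟨n, hn⟩ := ih hξ
    refine ⟨n, ?_⟩
    rw [← zero_add (diffAB _)]
    exact .step (.eps hτ) ht hm hn
  | @read q p z m m' s qs ts hτ ht hm _ ih =>
    change Symb₂ at s
    cases s with
    | sigma => exact absurd hξ not_isOverAB_sigma
    | a =>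
      obtain ⟨n, hn⟩ := ih (0 : Fin 1) (isOverAB_a.1 hξ)
      refine ⟨n, ?_⟩
      exact .of_eq (.step (.a hτ) ht hm hn) (diffAB_a ts).symm
    | b =>
      obtain ⟨n, hn⟩ := ih (0 : Fin 1) (isOverAB_b.1 hξ)
      refine ⟨n, ?_⟩
      exact .of_eq (.step (.b hτ) ht hm hn) (diffAB_b ts).symm
    | hash =>
      exact ⟨m', .of_eq (.step (.hash hτ) ht hm (.refl _ _)) (diffAB_hash ts).symm⟩

/-- What a run of `ABRel` from the state `p` to the final state says about acceptance. -/
def ABAccepts (A : GOCTA alphabet₂) (m : ℕ) (x : ℤ) : Option A.Q → Prop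
  | some q => ∃ ξ, IsOverAB ξ ∧ diffAB ξ = x ∧ A.CopyAccepts q m ξ
  | none => x = 0

/-- Labels keep only the difference of `a` and `b`, so a pumped run is read back as some accepted
tree with that difference, which is all that membership needs. -/
theorem abAccepts_of_counterRun {p f : Option A.Q} {m n : ℕ} {x : ℤ}
    (h : CounterRun (ABRel A) p m x f n) (hf : f = none) : ABAccepts A m x p := by
  induction h with
  | refl => subst hf; rfl
  | step hR ht hm _ ih =>
    have ih := ih hf
    cases hR with
    | eps hτ =>
      obtain ⟨ξ, h, hx, hξ⟩ := ih
      exact ⟨ξ, h, by rw [hx, zero_add], .eps hτ ht hm hξ⟩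
    | a hτ =>
      obtain ⟨ξ, h, hx, hξ⟩ := ih
      exact ⟨_, isOverAB_a (ts := fun _ => ξ).2 h, by rw [diffAB_a, hx],
        .read hτ ht hm fun i => by cases Subsingleton.elim (α := Fin 1) i 0; exact hξ⟩
    | b hτ =>
      obtain ⟨ξ, h, hx, hξ⟩ := ih
      exact ⟨_, isOverAB_b (ts := fun _ => ξ).2 h, by rw [diffAB_b, hx],
        .read hτ ht hm fun i => by cases Subsingleton.elim (α := Fin 1) i 0; exact hξ⟩
    | hash hτ =>
      exact ⟨_, isOverAB_hash (ts := Fin.elim0), by rw [diffAB_hash, show _ = (0 : ℤ) from ih]; rfl,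
        .read hτ ht hm fun i => Fin.elim0 i⟩

theorem not_octa_langAEqB : ¬ OCTARecognizable langAEqB := by
  rintro ⟨A, hA⟩
  have := A.finite_states
  obtain ⟨Z, hZ⟩ := A.exists_instr_bound
  choose w hw hwd using exists_diffAB_eq
  -- The first branch is to be pumped, the second makes the counter unbounded for fixed `K`, and the
  -- third balances the sum.
  let ts (K y : ℕ) : Fin 3 → GroundTree alphabet₂ := ![w K, w y, w (-K - y)]
  have hts : ∀ K y i, IsOverAB (ts K y i) := by
    intro K y i
    fin_cases i
    exacts [hw _, hw _, hw _]
  have hex : ∀ K y : ℕ, ∃ (qs : Fin 3 → A.Q) (m : ℕ),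
      (∀ i, A.CopyAccepts (qs i) m (ts K y i)) ∧
      ∀ us : Fin 3 → GroundTree alphabet₂, (∀ i, IsOverAB (us i)) →
        (∀ i, A.CopyAccepts (qs i) m (us i)) →
        diffAB (us 0) + diffAB (us 1) + diffAB (us 2) = 0 := by
    intro K y
    have h : sigma₂ (ts K y) ∈ langAEqB := (sigma₂_mem_langAEqB_iff (hts K y)).2 (by simp [ts, hwd])
    obtain ⟨qs, m, h₁, h₂⟩ := (GOCTA.mem_copyLanguage.1 (hA ▸ h)).exists_read
    exact ⟨qs, m, h₁, fun us hu h => (sigma₂_mem_langAEqB_iff hu).1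
      (hA ▸ GOCTA.mem_copyLanguage.2 (h₂ us h))⟩
  choose qs m hacc H using hex
  have hinj : ∀ K, Function.Injective fun y => (qs K y, m K y) := by
    intro K y y' h
    simp only [Prod.mk.injEq] at h
    have := H K y ![w K, w y', w (-K - y)] (by
      intro i; fin_cases i; exacts [hw _, hw _, hw _]) (by
      intro i
      fin_cases i
      · exact hacc K y 0
      · have := hacc K y' 1
        rwa [← h.1, ← h.2] at this
      · exact hacc K y 2)
    simp [hwd] at this
    omega
  -- Exchange of the first branch, with the other two kept.
  have huniq : ∀ K y ξ, IsOverAB ξ → A.CopyAccepts (qs K y 0) (m K y) ξ → diffAB ξ = K := by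
    intro K y ξ hξ h
    have := H K y ![ξ, w y, w (-K - y)] (by
      intro i; fin_cases i; exacts [hξ, hw _, hw _]) (by
      intro i
      fin_cases i
      exacts [h, hacc K y 1, hacc K y 2])
    simp [hwd] at this
    omega
  set B := (Nat.card (Option A.Q) + 1) * (Z + 1) with hB
  have : NeZero B.factorial := ⟨B.factorial_ne_zero⟩
  choose col ρ hcol using fun K => exists_frequent_color B.factorial (hinj K)
  -- There are infinitely many `K` but only finitely many pairs of a state tuple and a residue.
  obtain ⟨K, K', hne, hcc⟩ := Finite.exists_ne_map_eq_of_infinite fun K => (col K, ρ K)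
  simp only [Prod.mk.injEq] at hcc hcol
  obtain ⟨y, hy, hs, hρ⟩ := hcol K B
  obtain ⟨n, hrun⟩ := counterRun_of_copyAccepts (hacc K y 0) (hts K y 0)
  obtain ⟨g, δ, hg₁, hg₂, -, hpump⟩ := hrun.exists_pump (ABRel.abs_le hZ)
    (le_trans (by rw [hB]; gcongr; omega) hy)
  have key : ∀ L y', m K y < m L y' → col L = col K → ρ L = ρ K → qs L y' = col L →
      (m L y' : ZMod B.factorial) = ρ L → ∃ k : ℕ, 1 ≤ k ∧ (K : ℤ) + k * δ = L := by
    intro L y' hlt hc hr hs' hρ'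
    obtain ⟨k, hk, e⟩ := exists_eq_add_mul (Nat.dvd_factorial hg₁ hg₂) hlt
      ((hρ.trans hr.symm).trans hρ'.symm)
    refine ⟨k, hk, ?_⟩
    obtain ⟨n', hn'⟩ := hpump k
    rw [← e, hs, ← hc, ← hs'] at hn'
    obtain ⟨ξ, hξ, hx, ha⟩ := abAccepts_of_counterRun hn' rfl
    rw [← huniq L y' ξ hξ ha, hx]
    simp [ts, hwd]
  obtain ⟨y₁, hy₁, hs₁, hρ₁⟩ := hcol K (m K y + 1)
  obtain ⟨y₂, hy₂, hs₂, hρ₂⟩ := hcol K' (m K y + 1)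
  obtain ⟨k₁, hk₁, e₁⟩ := key K y₁ hy₁ rfl rfl hs₁ hρ₁
  obtain ⟨k₂, hk₂, e₂⟩ := key K' y₂ hy₂ hcc.1.symm hcc.2.symm hs₂ hρ₂
  -- The target `K` itself gives `K + k₁ * δ = K` with `k₁ ≥ 1`.
  have hδ : δ = 0 := by
    have : (k₁ : ℤ) * δ = 0 := by omega
    rcases mul_eq_zero.1 this with h | h
    · omega
    · exact h
  rw [hδ] at e₂
  exact hne (by simpa using e₂)

end AEqB

/-! ### An automaton with copied counters for `aⁿ(σ(bⁿ#, cⁿ#))` -/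

section ASigmaBC

open Trees₁

/-- The automaton that counts up on `a`, and counts down to zero on `b` and on `c`. -/
def automatonASigmaBC : GOCTA alphabet₁ where
  Q := Fin 3
  finite_states := inferInstance
  init := 0
  trans :=
    {⟨0, .top, 1, .read (S := alphabet₁) Symb₁.a fun _ => 0⟩,
      ⟨0, .top, 0, .read (S := alphabet₁) Symb₁.sigma ![1, 2]⟩,
      ⟨1, .top, -1, .read (S := alphabet₁) Symb₁.b fun _ => 1⟩,
      ⟨1, .zero, 0, .read (S := alphabet₁) Symb₁.hash fun _ => 1⟩,
      ⟨2, .top, -1, .read (S := alphabet₁) Symb₁.c fun _ => 2⟩,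
      ⟨2, .zero, 0, .read (S := alphabet₁) Symb₁.hash fun _ => 2⟩}
  finite_trans := Set.toFinite _

/-- The trees accepted by `automatonASigmaBC` from its states. -/
def AcceptedASigmaBC (m : ℕ) (ξ : GroundTree alphabet₁) : Fin 3 → Prop
  | 0 => ∃ n, ξ = a^[n] (sigma (b^[m + n] hash) (c^[m + n] hash))
  | 1 => ξ = b^[m] hash
  | 2 => ξ = c^[m] hash

/-- Each branch below `σ` receives its own copy of the number of symbols `a`. Decrementing, together
with the zero test at `#`, makes it spend exactly that amount. -/
theorem acceptedASigmaBC_of_copyAccepts {q : automatonASigmaBC.Q} {m : ℕ} {ξ : GroundTree alphabet₁}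
    (h : automatonASigmaBC.CopyAccepts q m ξ) : AcceptedASigmaBC m ξ q := by
  induction h with
  | eps hτ => rcases hτ with h | h | h | h | h | h <;> cases h
  | @read q p z m m' s qs ts hτ ht hm _ ih =>
    rcases hτ with h | h | h | h | h | h <;> cases h
    · obtain ⟨n, hn⟩ := ih (0 : Fin 1)
      refine ⟨n + 1, ?_⟩
      have : m' = m + 1 := by exact_mod_cast hm
      subst this
      rw [Function.iterate_succ_apply', ← Nat.add_assoc, Nat.add_right_comm, ← hn]
      exact congrArg (RTree.node (S := alphabet₁) Symb₁.a)
        (funext fun i => congrArg ts (Subsingleton.elim (α := Fin 1) i 0))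
    · refine ⟨0, ?_⟩
      have : m' = m := by simpa using hm
      subst this
      have h₁ : ts (0 : Fin 2) = b^[m'] hash := ih (0 : Fin 2)
      have h₂ : ts (1 : Fin 2) = c^[m'] hash := ih (1 : Fin 2)
      refine congrArg (RTree.node (S := alphabet₁) Symb₁.sigma) (funext fun i => ?_)
      change Fin 2 at i
      fin_cases i
      exacts [h₁, h₂]
    · have : m = m' + 1 := by omega
      subst this
      have h₁ : ts (0 : Fin 1) = b^[m'] hash := ih (0 : Fin 1)
      refine Eq.trans ?_ (Function.iterate_succ_apply' b m' hash).symm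
      rw [← h₁]
      exact congrArg (RTree.node (S := alphabet₁) Symb₁.b)
        (funext fun i => congrArg ts (Subsingleton.elim (α := Fin 1) i 0))
    · cases (show m = 0 from ht)
      exact congrArg (RTree.node (S := alphabet₁) Symb₁.hash) (funext fun i => Fin.elim0 i)
    · have : m = m' + 1 := by omega
      subst this
      have h₁ : ts (0 : Fin 1) = c^[m'] hash := ih (0 : Fin 1)
      refine Eq.trans ?_ (Function.iterate_succ_apply' c m' hash).symm
      rw [← h₁]
      exact congrArg (RTree.node (S := alphabet₁) Symb₁.c)
        (funext fun i => congrArg ts (Subsingleton.elim (α := Fin 1) i 0))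
    · cases (show m = 0 from ht)
      exact congrArg (RTree.node (S := alphabet₁) Symb₁.hash) (funext fun i => Fin.elim0 i)

theorem copyAccepts_iterate_b (m : ℕ) :
    automatonASigmaBC.CopyAccepts (1 : Fin 3) m (b^[m] hash) := by
  induction m with
  | zero => exact .read (m' := 0) (.inr (.inr (.inr (.inl rfl)))) rfl rfl fun i => Fin.elim0 i
  | succ m ih =>
    rw [Function.iterate_succ_apply']
    exact .read (m' := m) (.inr (.inr (.inl rfl))) trivial (by push_cast; ring) fun _ => ih

theorem copyAccepts_iterate_c (m : ℕ) :
    automatonASigmaBC.CopyAccepts (2 : Fin 3) m (c^[m] hash) := by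
  induction m with
  | zero =>
    exact .read (m' := 0) (.inr (.inr (.inr (.inr (.inr rfl))))) rfl rfl fun i => Fin.elim0 i
  | succ m ih =>
    rw [Function.iterate_succ_apply']
    exact .read (m' := m) (.inr (.inr (.inr (.inr (.inl rfl))))) trivial (by push_cast; ring)
      fun _ => ih

theorem copyAccepts_iterate_a (n m : ℕ) : automatonASigmaBC.CopyAccepts (0 : Fin 3) m
    (a^[n] (sigma (b^[m + n] hash) (c^[m + n] hash))) := by
  induction n generalizing m with
  | zero =>
    refine .read (m' := m) (.inr (.inl rfl)) trivial (by simp) fun i => ?_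
    change Fin 2 at i
    fin_cases i
    exacts [copyAccepts_iterate_b m, copyAccepts_iterate_c m]
  | succ n ih =>
    rw [Function.iterate_succ_apply', ← Nat.add_assoc, Nat.add_right_comm]
    exact .read (m' := m + 1) (.inl rfl) trivial (by push_cast; ring) fun _ => ih (m + 1)

theorem octa_langASigmaBC : OCTARecognizable langASigmaBC := by
  refine ⟨automatonASigmaBC, Set.ext fun ξ => GOCTA.mem_copyLanguage.trans ⟨fun h => ?_, ?_⟩⟩
  · obtain ⟨n, hn⟩ := acceptedASigmaBC_of_copyAccepts h
    exact ⟨n, by simpa using hn⟩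
  · rintro ⟨n, rfl⟩
    have := copyAccepts_iterate_a n 0
    rwa [Nat.zero_add] at this

end ASigmaBC

/-! ### An automaton with a global counter for `|ξ|_a = |ξ|_b` -/

section AEqB

/-- The sign encoded by a Boolean value. -/
def boolSign (s : Bool) : ℤ := if s then 1 else -1

/-- The automaton that keeps the absolute value of the current difference in its counter.
A state `(s, e)` consists of the sign `s` of the difference and the guessed sign `e` of the
difference at the end of the current subtree; the last subtree has no such guess. -/
def automatonAEqB : GOCTA alphabet₂ where
  Q := Option (Bool × Option Bool)
  finite_states := inferInstance
  init := none
  trans :=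
    (Set.range fun e : Bool × Bool => ⟨none, .top, 0, .read (S := alphabet₂) Symb₂.sigma
      ![some (true, some e.1), some (e.1, some e.2), some (e.2, none)]⟩) ∪
    (Set.range fun x : Bool × Option Bool => ⟨some x, .top, boolSign x.1,
      .read (S := alphabet₂) Symb₂.a fun _ => some x⟩) ∪
    (Set.range fun x : Bool × Option Bool => ⟨some x, .top, -boolSign x.1,
      .read (S := alphabet₂) Symb₂.b fun _ => some x⟩) ∪
    (Set.range fun x : Bool × Option Bool => ⟨some x, .zero, 0, .eps (some (!x.1, x.2))⟩) ∪
    (Set.range fun s : Bool => ⟨some (s, some s), .top, 0,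
      .read (S := alphabet₂) Symb₂.hash fun _ => none⟩) ∪
    (Set.range fun s : Bool => ⟨some (s, none), .zero, 0,
      .read (S := alphabet₂) Symb₂.hash fun _ => none⟩)
  finite_trans := by
    refine (((((Set.finite_range _).union ?_).union ?_).union ?_).union ?_).union ?_ <;>
      exact Set.finite_range _

/-- The difference at the end of a subtree, given the guessed sign and the counter. -/
def finalDiff (n : ℕ) : Option Bool → ℤ
  | some e => boolSign e * n
  | none => 0

/-- The trees accepted by `automatonAEqB` from its states. -/
def AcceptedAEqB (m : ℕ) (ξ : GroundTree alphabet₂) (n : ℕ) :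
    Option (Bool × Option Bool) → Prop
  | some (s, e) => IsOverAB ξ ∧ boolSign s * m + diffAB ξ = finalDiff n e
  | none => m = 0 → ξ ∈ langAEqB

theorem boolSign_mul_self (s : Bool) : boolSign s * boolSign s = 1 := by cases s <;> rfl

/-- The invariant is that `boolSign s * m` is the difference accumulated so far. Guesses are
verified at each `#`, so the equations for the three subtrees telescope to total difference zero. -/
theorem acceptedAEqB_of_globalAccepts {q : automatonAEqB.Q} {m n : ℕ}
    {ξ : GroundTree alphabet₂} (h : automatonAEqB.GlobalAccepts q m ξ n) :
    AcceptedAEqB m ξ n q := by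
  induction h with
  | eps hτ ht hm _ ih =>
    rcases hτ with ((((⟨x, h⟩ | ⟨x, h⟩) | ⟨x, h⟩) | ⟨x, h⟩) | ⟨x, h⟩) | ⟨x, h⟩ <;> cases h
    cases (show _ = 0 from ht)
    simp only [Nat.cast_zero, add_zero, Nat.cast_eq_zero] at hm
    subst hm
    exact ⟨ih.1, by simpa using ih.2⟩
  | @read q p z m s qs ts c hτ ht hm _ ih =>
    rcases hτ with ((((⟨x, h⟩ | ⟨x, h⟩) | ⟨x, h⟩) | ⟨x, h⟩) | ⟨x, h⟩) | ⟨x, h⟩ <;> cases h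
    · intro h0
      obtain ⟨o₀, h₀⟩ := ih (0 : Fin 3)
      obtain ⟨o₁, h₁⟩ := ih (1 : Fin 3)
      obtain ⟨o₂, h₂⟩ := ih (2 : Fin 3)
      refine (sigma₂_mem_langAEqB_iff (ts := ts) fun i => ?_).2 ?_
      · fin_cases i
        exacts [o₀, o₁, o₂]
      · subst h0
        have hc : (c 0 : ℤ) = 0 := by simpa using hm
        change boolSign true * (c 0 : ℤ) + diffAB (ts (0 : Fin 3)) = boolSign x.1 * c 1 at h₀
        change boolSign x.1 * (c 1 : ℤ) + diffAB (ts (1 : Fin 3)) = boolSign x.2 * c 2 at h₁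
        change boolSign x.2 * (c 2 : ℤ) + diffAB (ts (2 : Fin 3)) = 0 at h₂
        rw [hc] at h₀
        linarith
    · obtain ⟨o, h⟩ := ih (0 : Fin 1)
      refine ⟨isOverAB_a.2 o, ?_⟩
      have := diffAB_a ts
      have hs := boolSign_mul_self x.1
      change boolSign x.1 * (c 0 : ℤ) + diffAB (ts (0 : Fin 1)) = finalDiff (c 1) x.2 at h
      change _ + diffAB _ = finalDiff (c 1) x.2
      rw [this, ← h, hm]
      linear_combination -hs
    · obtain ⟨o, h⟩ := ih (0 : Fin 1)
      refine ⟨isOverAB_b.2 o, ?_⟩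
      have := diffAB_b ts
      have hs := boolSign_mul_self x.1
      change boolSign x.1 * (c 0 : ℤ) + diffAB (ts (0 : Fin 1)) = finalDiff (c 1) x.2 at h
      change _ + diffAB _ = finalDiff (c 1) x.2
      rw [this, ← h, hm]
      linear_combination hs
    · refine ⟨isOverAB_hash, ?_⟩
      have := diffAB_hash ts
      change _ + diffAB _ = boolSign x * (c 0 : ℤ)
      rw [this, hm]
      ring
    · refine ⟨isOverAB_hash, ?_⟩
      have := diffAB_hash ts
      cases (show m = 0 from ht)
      change _ + diffAB _ = (0 : ℤ)
      rw [this]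
      simp

/-- Zero has either sign, so the ε-transitions may flip the sign when the counter is zero. -/
theorem globalAccepts_switch {s : Bool} {e : Option Bool} {n : ℕ} {ξ : GroundTree alphabet₂}
    (h : automatonAEqB.GlobalAccepts (some (!s, e) : Option (Bool × Option Bool)) 0 ξ n) :
    automatonAEqB.GlobalAccepts (some (s, e) : Option (Bool × Option Bool)) 0 ξ n :=
  .eps (m' := 0) (.inl (.inl (.inr ⟨(s, e), rfl⟩))) rfl rfl h

/-- The sign is flipped exactly when a symbol would push the counter below zero, or at `#` when zero
carries the wrong sign for the guess. The hypothesis `hn` is needed because `finalDiff n none` does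
not depend on `n`. -/
theorem globalAccepts_automatonAEqB {ξ : GroundTree alphabet₂} (hξ : IsOverAB ξ) {s : Bool}
    {m n : ℕ} {e : Option Bool} (hd : boolSign s * m + diffAB ξ = finalDiff n e)
    (hn : e = none → n = 0) :
    automatonAEqB.GlobalAccepts (some (s, e) : Option (Bool × Option Bool)) m ξ n := by
  induction ξ generalizing s m with
  | leaf h => exact h.elim
  | node x ts ih =>
    change Symb₂ at x
    cases x with
    | sigma => exact absurd hξ not_isOverAB_sigma
    | a =>
      have hrec : ∀ (s : Bool) (m m' : ℕ), (m' : ℤ) = m + boolSign s →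
          boolSign s * m + diffAB (RTree.node (S := alphabet₂) Symb₂.a ts) = finalDiff n e →
          automatonAEqB.GlobalAccepts (some (s, e) : Option (Bool × Option Bool)) m
            (RTree.node (S := alphabet₂) Symb₂.a ts) n := by
        intro s m m' hm hd
        refine .read_unary rfl (.inl (.inl (.inl (.inl (.inr ⟨(s, e), rfl⟩))))) trivial hm
          fun i => ?_
        cases Subsingleton.elim (α := Fin 1) i 0
        refine ih (0 : Fin 1) (isOverAB_a.1 hξ) ?_
        have h := diffAB_a ts
        have hs := boolSign_mul_self s
        rw [h] at hd
        rw [hm]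
        linear_combination hd + hs
      cases s with
      | true => exact hrec true m (m + 1) (by simp [boolSign]) hd
      | false =>
        rcases m with _ | m
        · exact globalAccepts_switch (hrec true 0 1 rfl (by simpa using hd))
        · exact hrec false (m + 1) m (by simp [boolSign]) hd
    | b =>
      have hrec : ∀ (s : Bool) (m m' : ℕ), (m' : ℤ) = m + -boolSign s →
          boolSign s * m + diffAB (RTree.node (S := alphabet₂) Symb₂.b ts) = finalDiff n e →
          automatonAEqB.GlobalAccepts (some (s, e) : Option (Bool × Option Bool)) m
            (RTree.node (S := alphabet₂) Symb₂.b ts) n := by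
        intro s m m' hm hd
        refine .read_unary rfl (.inl (.inl (.inl (.inr ⟨(s, e), rfl⟩)))) trivial hm
          fun i => ?_
        cases Subsingleton.elim (α := Fin 1) i 0
        refine ih (0 : Fin 1) (isOverAB_b.1 hξ) ?_
        have h := diffAB_b ts
        have hs := boolSign_mul_self s
        rw [h] at hd
        rw [hm]
        linear_combination hd - hs
      cases s with
      | false => exact hrec false m (m + 1) (by simp [boolSign]) hd
      | true =>
        rcases m with _ | m
        · exact globalAccepts_switch (hrec false 0 1 rfl (by simpa using hd))
        · exact hrec true (m + 1) m (by simp [boolSign]) hd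
    | hash =>
      have h := diffAB_hash ts
      have hd : boolSign s * m = finalDiff n e := by
        rw [← hd]
        exact ((congrArg _ h).trans (add_zero _)).symm
      rcases e with _ | e
      · cases hn rfl
        have : m = 0 := by
          cases s <;> simpa [boolSign, finalDiff] using hd
        subst this
        exact .read_nullary rfl (.inr ⟨s, rfl⟩) rfl rfl
      · have hread : ∀ k, automatonAEqB.GlobalAccepts
            (some (e, some e) : Option (Bool × Option Bool)) k
            (RTree.node (S := alphabet₂) Symb₂.hash ts) k := fun k =>
          .read_nullary rfl (.inl (.inr ⟨e, rfl⟩)) trivial (by simp)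
        -- Signed values agree, so the signs can differ only if both counters are zero.
        have hcases : (s = e ∧ m = n) ∨ (s = !e ∧ m = 0 ∧ n = 0) := by
          cases s <;> cases e <;> simp [boolSign, finalDiff] at hd ⊢ <;> omega
        rcases hcases with ⟨rfl, rfl⟩ | ⟨rfl, rfl, rfl⟩
        · exact hread m
        · exact globalAccepts_switch (by simpa using hread 0)

theorem exists_boolSign_mul (v : ℤ) : ∃ (e : Bool) (n : ℕ), boolSign e * n = v := by
  rcases le_total 0 v with h | h
  · exact ⟨true, v.toNat, by simp [boolSign, h]⟩
  · exact ⟨false, (-v).toNat, by simp [boolSign, h]⟩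

theorem gocta_langAEqB : GOCTARecognizable langAEqB := by
  refine ⟨automatonAEqB, Set.ext fun ξ => GOCTA.mem_language.trans ⟨?_, fun h => ?_⟩⟩
  · rintro ⟨n, h⟩
    exact acceptedAEqB_of_globalAccepts h rfl
  · obtain ⟨ts, rfl, ho, hd⟩ := mem_langAEqB_iff.1 h
    obtain ⟨e₁, n₁, h₁⟩ := exists_boolSign_mul (diffAB (ts 0))
    obtain ⟨e₂, n₂, h₂⟩ := exists_boolSign_mul (diffAB (ts 0) + diffAB (ts 1))
    refine ⟨0, ?_⟩
    refine GOCTA.GlobalAccepts.read (A := automatonAEqB) (S := alphabet₂) (s := Symb₂.sigma)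
      -- Absolute values of the partial differences at the subtree boundaries; only the indices `0`
      -- to `3` matter, so the wrap-around of `Fin.ofNat` is harmless.
      (fun i => (![0, n₁, n₂, 0] : Fin 4 → ℕ) (Fin.ofNat 4 i))
      (.inl (.inl (.inl (.inl (.inl ⟨(e₁, e₂), rfl⟩))))) trivial rfl fun i => ?_
    change Fin 3 at i
    fin_cases i
    · exact globalAccepts_automatonAEqB (e := some e₁) (s := true) (m := 0) (n := n₁) (ho 0)
        (by simp [finalDiff, h₁]) (by simp)
    · exact globalAccepts_automatonAEqB (e := some e₂) (s := e₁) (m := n₁) (n := n₂) (ho 1)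
        (by simp [finalDiff, h₁, h₂]) (by simp)
    · exact globalAccepts_automatonAEqB (e := none) (s := e₂) (m := n₂) (n := 0) (ho 2)
        (by simp [finalDiff, h₂, hd]) (by simp)

end AEqB

end TreeCounter

theorem mainTheorem3 :
    (TreeCounter.OCTARecognizable TreeCounter.langASigmaBC ∧
      ¬ TreeCounter.GOCTARecognizable TreeCounter.langASigmaBC) ∧
    (TreeCounter.GOCTARecognizable TreeCounter.langAEqB ∧
      ¬ TreeCounter.OCTARecognizable TreeCounter.langAEqB) ∧
    ¬ (TreeCounter.classOCTA ⊆ TreeCounter.classGOCTA) ∧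
    ¬ (TreeCounter.classGOCTA ⊆ TreeCounter.classOCTA) := by
  refine ⟨⟨TreeCounter.octa_langASigmaBC, TreeCounter.not_gocta_langASigmaBC⟩,
    ⟨TreeCounter.gocta_langAEqB, TreeCounter.not_octa_langAEqB⟩, fun h => ?_, fun h => ?_⟩
  · exact TreeCounter.not_gocta_langASigmaBC
      (h (show ⟨_, TreeCounter.langASigmaBC⟩ ∈ TreeCounter.classOCTA from
        TreeCounter.octa_langASigmaBC))
  · exact TreeCounter.not_octa_langAEqB
      (h (show ⟨_, TreeCounter.langAEqB⟩ ∈ TreeCounter.classGOCTA from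
        TreeCounter.gocta_langAEqB))
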